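/- Fix integers $M,L\ge 1$ and reals $P>0$, $\sigma^2\ge 0$. In the oversampled Wiener phase noise (OWPN) channel with oversampling factor $L$, the input $X_1^M=(X_1,\dots,X_M)\in\mathbb C^M$ produces the output $$Y_n = X_{\lceil n/L\rceil}\,e^{j\Theta_n}+W_n,\qquad n=1,\dots,ML,$$ where $\Theta_0$ is uniform on $[0,2\pi)$, $\Theta_n=\Theta_{n-1}+N_n$, the $N_n$ are i.i.d. $\mathcal N(0,\sigma^2/L)$, the $W_n$ are i.i.d. $\mathcal{CN}(0,2)$ (circularly symmetric complex Gaussian with variance $1$ per real dimension), and $X_1^M$, $\Theta_0$, $(N_n)$, $(W_n)$ are independent. Its capacity is $$\mathcal C^{\rm OWPN}(P,L,\sigma^2)=\limsup_{M\to\infty}\ \sup\ \frac1M I(X_1^M;Y_1^{ML}),$$ where the supremum is over all laws of $X_1^M$ with $\frac1M\sum_{m=1}^M\mathbb E|X_m|^2\le P/L$. Let $\mathcal C^{\rm AWGN}(P)$ be the capacity, defined in the same way, of the AWGN channel $Y_m=X_m+W_m$, $m=1,\dots,M$, with $W_m$ i.i.d. $\mathcal{CN}(0,2)$ independent of $X_1^M$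 and power constraint $\frac1M\sum_{m=1}^M\mathbb E|X_m|^2\le P$. Logarithms and mutual informations are in nats. Then for all $P>0$, all integers $L\ge1$ and all $\sigma^2\ge0$, $$\mathcal C^{\rm OWPN}(P,L,\sigma^2)\le\mathcal C^{\rm AWGN}(P)<\infty .$$ If moreover $P>1.5$ and $\sigma^2<\frac1{2P}$, then $$\mathcal C^{\rm AWGN}(P)-\mathcal C^{\rm OWPN}(P,L,\sigma^2)\le\tfrac12\log(2\pi e).$$ -/

import Mathlib

open MeasureTheory ProbabilityTheory Filter
open scoped ENNReal NNReal

noncomputable section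

namespace PhaseNoise

/-- The uniform distribution on `[0, 2π)`. -/
def uniformPhase : Measure ℝ :=
  ProbabilityTheory.cond volume (Set.Ico 0 (2 * Real.pi))

/-- The circularly symmetric complex Gaussian law `CN(0, v)`: independent real and imaginary
parts, each centred Gaussian with variance `v / 2`. -/
def complexGaussian (v : ℝ≥0) : Measure ℂ :=
  ((gaussianReal 0 (v / 2)).prod (gaussianReal 0 (v / 2))).map
    (fun p : ℝ × ℝ => (⟨p.1, p.2⟩ : ℂ))

/-- The mutual information `I(X; Y)` in nats of two random variables on a probability space:
the Kullback-Leibler divergence of the joint law from the product of the marginal laws. -/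
def mutualInfo {Ω A B : Type*} [MeasurableSpace Ω] [MeasurableSpace A] [MeasurableSpace B]
    (μ : Measure Ω) (X : Ω → A) (Y : Ω → B) : ℝ≥0∞ :=
  InformationTheory.klDiv (μ.map (fun ω => (X ω, Y ω))) ((μ.map X).prod (μ.map Y))

/-- The average power constraint `(1/M) ∑ 𝔼|X_m|² ≤ p` for a law `μ` of `(X_1, …, X_M)`. -/
def PowerConstraint {M : ℕ} (p : ℝ) (μ : Measure (Fin M → ℂ)) : Prop :=
  (∑ m : Fin M, ∫⁻ x, ‖x m‖ₑ ^ 2 ∂μ) / M ≤ ENNReal.ofReal p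

/-- `sup (1/M) I(X_1^M; Y)` over all laws of the input `X_1^M` with average power at most `p`,
where `Y = out X ω` and the channel noise `ω` has law `ν` and is independent of `X`. -/
def blockCapacity {Ω B : Type*} [MeasurableSpace Ω] [MeasurableSpace B] (M : ℕ) (p : ℝ)
    (ν : Measure Ω) (out : (Fin M → ℂ) → Ω → B) : ℝ≥0∞ :=
  ⨆ (μ : Measure (Fin M → ℂ)) (_ : IsProbabilityMeasure μ) (_ : PowerConstraint p μ),
    mutualInfo (μ.prod ν) (fun z => z.1) (fun z => out z.1 z.2) / M

/-! ### The oversampled Wiener phase noise channel -/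

/-- The noise of the channel over `M` symbols with `L` samples per symbol: the initial phase
`Θ_0`, the phase increments `N_1, …, N_{ML}` and the additive noise `W_1, …, W_{ML}`
(the indices `1, …, ML` are shifted to `0, …, ML - 1`). -/
abbrev OWPNNoise (M L : ℕ) : Type :=
  ℝ × (Fin (M * L) → ℝ) × (Fin (M * L) → ℂ)

/-- Law of the noise: `Θ_0` uniform on `[0, 2π)`, `N_n ∼ N(0, σ²/L)`, `W_n ∼ CN(0, 2)`,
all independent. -/
def owpnNoiseLaw (M L : ℕ) (σsq : ℝ≥0) : Measure (OWPNNoise M L) :=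
  uniformPhase.prod
    ((Measure.pi fun _ : Fin (M * L) => gaussianReal 0 (σsq / L)).prod
      (Measure.pi fun _ : Fin (M * L) => complexGaussian 2))

/-- The Wiener phase `Θ_n = Θ_0 + N_1 + ⋯ + N_n`. -/
def phase {M L : ℕ} (ω : OWPNNoise M L) (n : Fin (M * L)) : ℝ :=
  ω.1 + ∑ k ∈ Finset.Iic n, ω.2.1 k

/-- The channel output `Y_n = X_{⌈n/L⌉} exp(j Θ_n) + W_n`; with indices starting at `0` the
symbol sent at sample `n` is number `⌊n/L⌋`, which is `n.divNat`. -/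
def owpnOutput (M L : ℕ) (x : Fin M → ℂ) (ω : OWPNNoise M L) : Fin (M * L) → ℂ :=
  fun n => x n.divNat * Complex.exp (Complex.I * (phase ω n : ℂ)) + ω.2.2 n

/-- The capacity in nats per symbol of the oversampled Wiener phase noise channel with power `P`,
oversampling factor `L` and frequency noise variance `σ²`; each symbol has power `P / L`. -/
def owpnCapacity (P : ℝ) (L : ℕ) (σsq : ℝ≥0) : ℝ≥0∞ :=
  limsup (fun M : ℕ => blockCapacity M (P / L) (owpnNoiseLaw M L σsq) (owpnOutput M L)) atTop

/-! ### The additive white Gaussian noise channel -/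

/-- Law of the additive noise `W_1, …, W_M`, i.i.d. `CN(0, 2)`. -/
def awgnNoiseLaw (M : ℕ) : Measure (Fin M → ℂ) :=
  Measure.pi fun _ : Fin M => complexGaussian 2

/-- The channel output `Y_m = X_m + W_m`. -/
def awgnOutput (M : ℕ) (x w : Fin M → ℂ) : Fin M → ℂ :=
  fun m => x m + w m

/-- The capacity in nats per symbol of the complex additive white Gaussian noise channel with
noise `CN(0, 2)` and power `P`. -/
def awgnCapacity (P : ℝ) : ℝ≥0∞ :=
  limsup (fun M : ℕ => blockCapacity M P (awgnNoiseLaw M) (awgnOutput M)) atTop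

end PhaseNoise

end

/-! ### Variational bounds for the Kullback-Leibler divergence and mutual information -/

namespace InformationTheory

-- The comparison rests on the explicit bounds `C_AWGN ≤ log(1 + P/2)` and `C_OWPN ≥ log(P / (3σ²P +
-- 4 + 4/P))`, together with the fact that the phase noise channel is a degraded Gaussian channel.
--
-- Upper bound (`mutualInfo_awgn_le`): in the mutual information the output law may be replaced by
-- any reference law at the cost of an increase. With the reference `CN(0, P + 2)^M` the divergence
-- is an integral of quadratic terms, and these are controlled by the power constraint.
--
-- Degradation (`blockCapacity_owpn_le`): scale the input by `√L` and send it through the Gaussian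
-- channel. Dividing the output by `√L` leaves noise with the law of a block average of `L` samples.
-- Repeating it `L` times, adding independent noise with its block averages removed, and rotating by
-- independent Wiener phases gives exactly the phase noise output. Data processing concludes.
--
-- Lower bound (`ofReal_le_owpnCapacity`): take i.i.d. inputs `CN(0, P/L)` and average the output
-- over each block. The two preceding symbols act as pilots for the unknown phase, and the rotated
-- block average estimates the current symbol. Two pilots are used because `1/|a|²` has infinite
-- mean for one complex Gaussian, whereas `1/(|a|² + |b|²)` has a finite one. The mean square error
-- is at most `d = (3σ²P + 4 + 4/P)/L`: phase drift contributes the first term and additive noise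
-- the others. The Donsker-Varadhan inequality, applied to the product of the decoding densities
-- `CN(estimate, d)`, yields `log(q/d)` nats per symbol with `q = P/L`, for all symbols but the
-- first two.
--
-- If `log(1 + P/2) ≤ ½ log(2πe)`, the gap is trivially small. Otherwise `P > 6.22`, and since `3σ²P
-- < 3/2` the two bounds differ by at most `½ log(2πe)` (`log_sub_half_log_le`).

/-- The Donsker-Varadhan lower bound. -/
theorem ofReal_integral_le_klDiv {α : Type*} [MeasurableSpace α] {P ν : Measure α}
    [IsProbabilityMeasure P] [IsProbabilityMeasure ν] {f : α → ℝ} (hf : Measurable f)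
    (hfP : Integrable f P) (hfR : ∫⁻ x, ENNReal.ofReal (Real.exp (f x)) ∂ν ≤ 1) :
    ENNReal.ofReal (∫ x, f x ∂P) ≤ klDiv P ν := by
  by_cases htop : klDiv P ν = ∞
  · simp [htop]
  obtain ⟨hac, hint⟩ := klDiv_ne_top_iff.1 htop
  have hexp : Integrable (fun x => Real.exp (f x)) ν := by
    refine ⟨hf.exp.aestronglyMeasurable, ?_⟩
    rw [hasFiniteIntegral_iff_ofReal (ae_of_all _ fun x => (Real.exp_pos _).le)]
    exact hfR.trans_lt ENNReal.one_lt_top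
  have hle : ∫ x, Real.exp (f x) ∂ν ≤ 1 := by
    rw [integral_eq_lintegral_of_nonneg_ae (ae_of_all _ fun x => (Real.exp_pos _).le)
      hf.exp.aestronglyMeasurable]
    exact ENNReal.toReal_le_of_le_ofReal zero_le_one (by simpa using hfR)
  have hpos : 0 < ∫ x, Real.exp (f x) ∂ν := integral_exp_pos hexp
  have := isProbabilityMeasure_tilted hexp
  -- The divergence of `P` from the tilted law is nonnegative. It equals `∫ llr P ν - ∫ f + log ∫
  -- exp f`, and the last term is at most `0`.
  have hac' : P ≪ ν.tilted f := hac.trans (absolutelyContinuous_tilted hexp)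
  have hint' : Integrable (llr P (ν.tilted f)) P := integrable_llr_tilted_right hac hfP hint hexp
  have h0 := integral_llr_add_sub_measure_univ_nonneg hac' hint'
  rw [integral_llr_tilted_right hac hfP hexp hint] at h0
  have hlog : Real.log (∫ x, Real.exp (f x) ∂ν) ≤ 0 := Real.log_nonpos hpos.le hle
  rw [klDiv_of_ac_of_integrable hac hint]
  apply ENNReal.ofReal_le_ofReal
  simp only [probReal_univ] at h0 ⊢
  linarith

/-- The divergence of a density with integrable logarithm. -/
theorem klDiv_withDensity_ofReal_exp {α : Type*} [MeasurableSpace α] {ν : Measure α}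
    [IsProbabilityMeasure ν] {f : α → ℝ} (hf : Measurable f)
    [IsProbabilityMeasure (ν.withDensity fun x => ENNReal.ofReal (Real.exp (f x)))]
    (hint : Integrable f (ν.withDensity fun x => ENNReal.ofReal (Real.exp (f x)))) :
    klDiv (ν.withDensity fun x => ENNReal.ofReal (Real.exp (f x))) ν =
      ENNReal.ofReal (∫ x, f x ∂(ν.withDensity fun x => ENNReal.ofReal (Real.exp (f x)))) := by
  set P := ν.withDensity fun x => ENNReal.ofReal (Real.exp (f x)) with hP
  have hac : P ≪ ν := withDensity_absolutelyContinuous _ _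
  have hllr : llr P ν =ᵐ[P] f := by
    have h : P.rnDeriv ν =ᵐ[ν] fun x => ENNReal.ofReal (Real.exp (f x)) :=
      Measure.rnDeriv_withDensity ν (by fun_prop)
    filter_upwards [hac.ae_le h] with x hx
    rw [llr, hx, ENNReal.toReal_ofReal (Real.exp_pos _).le, Real.log_exp]
  rw [klDiv_of_ac_of_integrable hac (hint.congr hllr.symm), integral_congr_ae hllr]
  simp

/-- Data processing applied to `e` and to its inverse. -/
theorem klDiv_map_equiv {α β : Type*} [MeasurableSpace α] [MeasurableSpace β]
    (P ν : Measure α) [IsFiniteMeasure P] [IsFiniteMeasure ν] (e : α ≃ᵐ β) :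
    klDiv (P.map e) (ν.map e) = klDiv P ν := by
  refine le_antisymm (klDiv_map_le _ _ e.measurable) ?_
  have h := klDiv_map_le (P.map e) (ν.map e) e.symm.measurable
  rwa [MeasurableEquiv.map_symm_map, MeasurableEquiv.map_symm_map] at h

theorem klDiv_prod_right {α β : Type*} [MeasurableSpace α] [MeasurableSpace β]
    (P ν : Measure α) [IsFiniteMeasure P] [IsFiniteMeasure ν] (ρ : Measure β)
    [IsProbabilityMeasure ρ] : klDiv (P.prod ρ) (ν.prod ρ) = klDiv P ν := by
  rw [← Measure.compProd_const, ← Measure.compProd_const, klDiv_compProd_left]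

end InformationTheory

namespace PhaseNoise

open InformationTheory

/-- The golden formula bound: replacing the output law by any law does not decrease the
divergence. -/
theorem mutualInfo_le_klDiv_prod {Ω A B : Type*} [MeasurableSpace Ω] [MeasurableSpace A]
    [StandardBorelSpace A] [Nonempty A] [MeasurableSpace B] {μ : Measure Ω}
    [IsProbabilityMeasure μ] {X : Ω → A} {Y : Ω → B} (hX : Measurable X) (hY : Measurable Y)
    (ρ : Measure B) [IsProbabilityMeasure ρ] :
    mutualInfo μ X Y ≤ klDiv (μ.map fun ω => (X ω, Y ω)) ((μ.map X).prod ρ) := by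
  have := Measure.isProbabilityMeasure_map (μ := μ) hX.aemeasurable
  have := Measure.isProbabilityMeasure_map (μ := μ) hY.aemeasurable
  have := Measure.isProbabilityMeasure_map (μ := μ) (hX.prodMk hY).aemeasurable
  -- With the output as first coordinate, the chain rule splits the right-hand side into `klDiv
  -- (μ.map Y) ρ` plus the mutual information, and the first summand is dropped.
  have hswap : ∀ ρ' : Measure B, IsProbabilityMeasure ρ' →
      klDiv (μ.map fun ω => (X ω, Y ω)) ((μ.map X).prod ρ') =
      klDiv (μ.map Y ⊗ₘ condDistrib X Y μ) (ρ' ⊗ₘ Kernel.const B (μ.map X)) := by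
    intro ρ' _
    rw [compProd_map_condDistrib hX.aemeasurable, Measure.compProd_const,
      ← klDiv_map_equiv _ _ MeasurableEquiv.prodComm]
    congr 1
    · rw [Measure.map_map (by fun_prop) (by fun_prop)]
      rfl
    · exact Measure.prod_swap
  rw [mutualInfo, hswap _ inferInstance, hswap _ inferInstance, klDiv_compProd_eq_add (ν := ρ)]
  exact le_add_self

/-! ### The complex Gaussian law -/

instance (v : ℝ≥0) : IsProbabilityMeasure (complexGaussian v) :=
  Measure.isProbabilityMeasure_map (by
    apply Measurable.aemeasurable
    exact Complex.measurableEquivRealProd.symm.measurable)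

theorem measurable_complex_mk : Measurable fun p : ℝ × ℝ => (⟨p.1, p.2⟩ : ℂ) :=
  Complex.measurableEquivRealProd.symm.measurable

theorem lintegral_complexGaussian {v : ℝ≥0} {f : ℂ → ℝ≥0∞} (hf : Measurable f) :
    ∫⁻ z, f z ∂complexGaussian v =
      ∫⁻ a, ∫⁻ b, f ⟨a, b⟩ ∂gaussianReal 0 (v / 2) ∂gaussianReal 0 (v / 2) := by
  rw [complexGaussian, lintegral_map hf measurable_complex_mk]
  exact lintegral_prod _ (hf.comp measurable_complex_mk).aemeasurable

/-- Exponential tilting between real Gaussian laws. -/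
theorem lintegral_gaussianReal_tilt {q d : ℝ≥0} (hq : q ≠ 0) (hd : d ≠ 0) (c : ℝ) {f : ℝ → ℝ≥0∞}
    (hf : Measurable f) :
    ∫⁻ r, ENNReal.ofReal (√(q / d) * Real.exp (r ^ 2 / (2 * q) - (r - c) ^ 2 / (2 * d))) * f r
      ∂gaussianReal 0 q = ∫⁻ r, f (c + r) ∂gaussianReal 0 d := by
  have hq' : (0 : ℝ) < q := by positivity
  have hd' : (0 : ℝ) < d := by positivity
  have h1 : ∫⁻ r, f (c + r) ∂gaussianReal 0 d = ∫⁻ r, f r ∂gaussianReal c d := by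
    rw [← lintegral_map (g := fun r => c + r) hf (by fun_prop), gaussianReal_map_const_add,
      zero_add]
  rw [h1, gaussianReal_of_var_ne_zero _ hq, gaussianReal_of_var_ne_zero _ hd,
    lintegral_withDensity_eq_lintegral_mul _ (measurable_gaussianPDF _ _) (by fun_prop),
    lintegral_withDensity_eq_lintegral_mul _ (measurable_gaussianPDF _ _) hf]
  congr 1 with r
  simp only [Pi.mul_apply, gaussianPDF]
  rw [← mul_assoc, ← ENNReal.ofReal_mul (gaussianPDFReal_nonneg _ _ _)]
  congr 2
  simp only [gaussianPDFReal]
  rw [mul_mul_mul_comm, ← Real.exp_add]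
  congr 1
  · rw [← Real.sqrt_inv, ← Real.sqrt_inv, ← Real.sqrt_mul (by positivity)]
    congr 1
    field_simp
  · congr 1
    ring

/-- Exponential tilting between complex Gaussian laws. -/
theorem lintegral_complexGaussian_tilt {q d : ℝ≥0} (hq : q ≠ 0) (hd : d ≠ 0) (c : ℂ)
    {f : ℂ → ℝ≥0∞} (hf : Measurable f) :
    ∫⁻ z, ENNReal.ofReal (q / d * Real.exp (‖z‖ ^ 2 / q - ‖z - c‖ ^ 2 / d)) * f z
      ∂complexGaussian q = ∫⁻ z, f (c + z) ∂complexGaussian d := by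
  have hq2 : q / 2 ≠ 0 := by positivity
  have hd2 : d / 2 ≠ 0 := by positivity
  rw [lintegral_complexGaussian (by fun_prop), lintegral_complexGaussian (by fun_prop)]
  have hm : Measurable fun p : ℝ × ℝ => f ⟨p.1, p.2⟩ := hf.comp measurable_complex_mk
  -- The density ratio factors over real and imaginary parts, each of variance `q / 2` or `d / 2`;
  -- the two square roots multiply to `q / d`.
  have key : ∀ a b : ℝ, ENNReal.ofReal (q / d * Real.exp (‖(⟨a, b⟩ : ℂ)‖ ^ 2 / q -
      ‖(⟨a, b⟩ : ℂ) - c‖ ^ 2 / d)) =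
      ENNReal.ofReal (√((q / 2 : ℝ≥0) / (d / 2 : ℝ≥0)) *
        Real.exp (a ^ 2 / (2 * (q / 2 : ℝ≥0)) - (a - c.re) ^ 2 / (2 * (d / 2 : ℝ≥0)))) *
      ENNReal.ofReal (√((q / 2 : ℝ≥0) / (d / 2 : ℝ≥0)) *
        Real.exp (b ^ 2 / (2 * (q / 2 : ℝ≥0)) - (b - c.im) ^ 2 / (2 * (d / 2 : ℝ≥0)))) := by
    intro a b
    rw [← ENNReal.ofReal_mul (by positivity), mul_mul_mul_comm,
      Real.mul_self_sqrt (by positivity), ← Real.exp_add]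
    have hq' : (q : ℝ) ≠ 0 := by exact_mod_cast hq
    have hd' : (d : ℝ) ≠ 0 := by exact_mod_cast hd
    congr 2
    · push_cast; field_simp
    · congr 1
      rw [← Complex.normSq_eq_norm_sq, ← Complex.normSq_eq_norm_sq, Complex.normSq_apply,
        Complex.normSq_apply]
      simp only [Complex.sub_re, Complex.sub_im]
      push_cast
      field_simp
      ring
  have hin : ∀ a : ℝ, ∫⁻ b, ENNReal.ofReal (q / d * Real.exp (‖(⟨a, b⟩ : ℂ)‖ ^ 2 / q -
      ‖(⟨a, b⟩ : ℂ) - c‖ ^ 2 / d)) * f ⟨a, b⟩ ∂gaussianReal 0 (q / 2) =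
      ENNReal.ofReal (√((q / 2 : ℝ≥0) / (d / 2 : ℝ≥0)) *
        Real.exp (a ^ 2 / (2 * (q / 2 : ℝ≥0)) - (a - c.re) ^ 2 / (2 * (d / 2 : ℝ≥0)))) *
      ∫⁻ b, f ⟨a, c.im + b⟩ ∂gaussianReal 0 (d / 2) := by
    intro a
    rw [← lintegral_gaussianReal_tilt hq2 hd2 c.im (f := fun b => f ⟨a, b⟩)
      (hm.comp measurable_prodMk_left), ← lintegral_const_mul]
    · simp_rw [key, mul_assoc]
    · exact Measurable.mul (by fun_prop) (hm.comp measurable_prodMk_left)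
  simp_rw [hin]
  have hm2 : Measurable fun a : ℝ => ∫⁻ b, f ⟨a, c.im + b⟩ ∂gaussianReal 0 (d / 2) := by
    apply Measurable.lintegral_prod_right
    exact hm.comp (f := fun p : ℝ × ℝ => (p.1, c.im + p.2)) (by fun_prop)
  rw [lintegral_gaussianReal_tilt hq2 hd2 c.re hm2]
  rfl

theorem lintegral_complexGaussian_tilt_one {q d : ℝ≥0} (hq : q ≠ 0) (hd : d ≠ 0) (c : ℂ) :
    ∫⁻ z, ENNReal.ofReal (q / d * Real.exp (‖z‖ ^ 2 / q - ‖z - c‖ ^ 2 / d))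
      ∂complexGaussian q = 1 := by
  simpa using lintegral_complexGaussian_tilt hq hd c (f := fun _ => 1) measurable_const

theorem memLp_id_complexGaussian (v : ℝ≥0) : MemLp (fun z => z) 2 (complexGaussian v) := by
  have hre : MemLp (fun z : ℂ => (z.re : ℂ)) 2 (complexGaussian v) := by
    apply MemLp.ofReal
    rw [complexGaussian, memLp_map_measure_iff (by fun_prop) measurable_complex_mk.aemeasurable]
    exact (memLp_id_gaussianReal (μ := 0) (v := v / 2) 2).comp_measurePreserving
      measurePreserving_fst
  have him : MemLp (fun z : ℂ => (z.im : ℂ)) 2 (complexGaussian v) := by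
    apply MemLp.ofReal
    rw [complexGaussian, memLp_map_measure_iff (by fun_prop) measurable_complex_mk.aemeasurable]
    exact (memLp_id_gaussianReal (μ := 0) (v := v / 2) 2).comp_measurePreserving
      measurePreserving_snd
  have := hre.add (him.mul_const Complex.I)
  refine this.ae_eq (ae_of_all _ fun z => ?_)
  simp

theorem lintegral_sq_gaussianReal (v : ℝ≥0) :
    ∫⁻ r, ENNReal.ofReal (r ^ 2) ∂gaussianReal 0 v = v := by
  have h := variance_fun_id_gaussianReal (μ := 0) (v := v)
  have hi : Integrable (fun r : ℝ => r ^ 2) (gaussianReal 0 v) :=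
    (memLp_id_gaussianReal (μ := 0) (v := v) 2).integrable_sq
  rw [← ofReal_integral_eq_lintegral_ofReal hi (ae_of_all _ fun r => sq_nonneg r)]
  rw [variance_of_integral_eq_zero (by fun_prop) (by simp)] at h
  simp [h]

theorem lintegral_enorm_sq_complexGaussian (v : ℝ≥0) :
    ∫⁻ z, ‖z‖ₑ ^ 2 ∂complexGaussian v = v := by
  rw [lintegral_complexGaussian (by fun_prop)]
  have : ∀ a b : ℝ, ‖(⟨a, b⟩ : ℂ)‖ₑ ^ 2 = ENNReal.ofReal (a ^ 2) + ENNReal.ofReal (b ^ 2) := by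
    intro a b
    rw [← ENNReal.ofReal_add (by positivity) (by positivity), ← ofReal_norm,
      ← ENNReal.ofReal_pow (by positivity), ← Complex.normSq_eq_norm_sq, Complex.normSq_apply]
    congr 1; ring
  simp_rw [this]
  have h1 : ∀ a : ℝ, ∫⁻ b, ENNReal.ofReal (a ^ 2) + ENNReal.ofReal (b ^ 2)
      ∂gaussianReal 0 (v / 2) = ENNReal.ofReal (a ^ 2) + ((v / 2 : ℝ≥0) : ℝ≥0∞) := by
    intro a
    rw [lintegral_add_left (by fun_prop), lintegral_sq_gaussianReal]; simp
  simp_rw [h1]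
  rw [lintegral_add_left (by fun_prop), lintegral_sq_gaussianReal]
  simp only [lintegral_const, measure_univ, mul_one]
  rw [← ENNReal.coe_add, add_halves]

theorem integral_id_complexGaussian (v : ℝ≥0) : ∫ z, z ∂complexGaussian v = 0 := by
  have hi : Integrable (fun z => z) (complexGaussian v) :=
    (memLp_id_complexGaussian v).integrable (by norm_num)
  rw [complexGaussian] at hi ⊢
  apply Complex.ext
  · rw [← RCLike.re_eq_complex_re, ← integral_re hi,
      integral_map measurable_complex_mk.aemeasurable (by fun_prop)]
    simp only [RCLike.re_eq_complex_re]
    rw [integral_fun_fst (μ := gaussianReal 0 (v / 2)) (ν := gaussianReal 0 (v / 2))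
      (fun x : ℝ => x)]
    simp
  · rw [← RCLike.im_eq_complex_im, ← integral_im hi,
      integral_map measurable_complex_mk.aemeasurable (by fun_prop)]
    simp only [RCLike.im_eq_complex_im]
    rw [integral_fun_snd (μ := gaussianReal 0 (v / 2)) (ν := gaussianReal 0 (v / 2))
      (fun x : ℝ => x)]
    simp

/-- The second moment of an affine function of a complex Gaussian variable. -/
theorem lintegral_enorm_affine_sq_complexGaussian (v : ℝ≥0) (α β : ℂ) :
    ∫⁻ z, ‖α + β * z‖ₑ ^ 2 ∂complexGaussian v = ‖α‖ₑ ^ 2 + ‖β‖ₑ ^ 2 * v := by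
  have hL := memLp_id_complexGaussian v
  have hi : Integrable (fun z => z) (complexGaussian v) := hL.integrable (by norm_num)
  have hsq : Integrable (fun z : ℂ => ‖z‖ ^ 2) (complexGaussian v) := hL.integrable_norm_pow (by norm_num)
  have hsq' : ∫ z, ‖z‖ ^ 2 ∂complexGaussian v = v := by
    rw [integral_eq_lintegral_of_nonneg_ae (ae_of_all _ fun z => by positivity) (by fun_prop)]
    simp_rw [ENNReal.ofReal_pow (norm_nonneg _), ofReal_norm]
    rw [lintegral_enorm_sq_complexGaussian]; simp
  have hexp : ∀ z : ℂ, ‖α + β * z‖ ^ 2 =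
      ‖α‖ ^ 2 + ‖β‖ ^ 2 * ‖z‖ ^ 2 + RCLike.re (2 * (starRingEnd ℂ) α * β * z) := by
    intro z
    rw [← Complex.normSq_eq_norm_sq, Complex.normSq_add, Complex.normSq_mul,
      Complex.normSq_eq_norm_sq, Complex.normSq_eq_norm_sq, Complex.normSq_eq_norm_sq]
    congr 1
    simp only [map_mul, Complex.mul_re, Complex.mul_im, Complex.conj_re, Complex.conj_im,
      RCLike.re_eq_complex_re, Complex.re_ofNat, Complex.im_ofNat]
    ring
  have hc : Integrable (fun z : ℂ => 2 * (starRingEnd ℂ) α * β * z) (complexGaussian v) :=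
    hi.const_mul _
  have hs1 : Integrable (fun z : ℂ => ‖α‖ ^ 2 + ‖β‖ ^ 2 * ‖z‖ ^ 2) (complexGaussian v) :=
    (integrable_const _).add (hsq.const_mul _)
  have hreal : ∫ z, ‖α + β * z‖ ^ 2 ∂complexGaussian v = ‖α‖ ^ 2 + ‖β‖ ^ 2 * v := by
    simp_rw [hexp]
    rw [integral_add hs1 hc.re, integral_re hc, integral_const_mul, integral_id_complexGaussian,
      integral_add (integrable_const _) (hsq.const_mul _), integral_const_mul, hsq']
    simp
  have hint : Integrable (fun z : ℂ => ‖α + β * z‖ ^ 2) (complexGaussian v) := by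
    simp_rw [hexp]; exact hs1.add hc.re
  have h := ofReal_integral_eq_lintegral_ofReal hint (ae_of_all _ fun z => by positivity)
  rw [hreal] at h
  simp_rw [ENNReal.ofReal_pow (norm_nonneg _), ofReal_norm] at h
  rw [← h, ENNReal.ofReal_add (by positivity) (by positivity), ENNReal.ofReal_mul (by positivity),
    ENNReal.ofReal_pow (by positivity), ENNReal.ofReal_pow (by positivity), ofReal_norm,
    ofReal_norm]
  simp

/-! ### Linear images of vectors of independent complex Gaussian variables -/

theorem charFunDual_complexGaussian (v : ℝ≥0) (l : StrongDual ℝ ℂ) :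
    charFunDual (complexGaussian v) l =
      Complex.exp (-(v / 4 * (l 1 ^ 2 + l Complex.I ^ 2) : ℝ)) := by
  have hl : ∀ a b : ℝ, l ⟨a, b⟩ = a * l 1 + b * l Complex.I := by
    intro a b
    have : (⟨a, b⟩ : ℂ) = a • (1 : ℂ) + b • Complex.I := by
      apply Complex.ext <;> simp
    rw [this, map_add, map_smul, map_smul]; rfl
  rw [charFunDual_apply, complexGaussian,
    integral_map measurable_complex_mk.aemeasurable (by fun_prop)]
  have hsplit : ∀ p : ℝ × ℝ, Complex.exp ((l ⟨p.1, p.2⟩ : ℝ) * Complex.I) =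
      Complex.exp ((l 1 : ℝ) * (p.1 : ℝ) * Complex.I) *
        Complex.exp ((l Complex.I : ℝ) * (p.2 : ℝ) * Complex.I) := by
    intro p
    rw [hl, ← Complex.exp_add]
    congr 1
    push_cast
    ring
  simp_rw [hsplit]
  rw [integral_prod_mul (fun a : ℝ => Complex.exp ((l 1 : ℝ) * (a : ℝ) * Complex.I))
    (fun a : ℝ => Complex.exp ((l Complex.I : ℝ) * (a : ℝ) * Complex.I)),
    ← charFun_apply_real, ← charFun_apply_real, charFun_gaussianReal, charFun_gaussianReal,
    ← Complex.exp_add]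
  congr 1
  push_cast
  ring

theorem charFunDual_pi_complexGaussian {ι : Type*} [Fintype ι] [DecidableEq ι] (v : ℝ≥0)
    (l : StrongDual ℝ (ι → ℂ)) :
    charFunDual (Measure.pi fun _ : ι => complexGaussian v) l =
      Complex.exp (-(v / 4 * ∑ i, (l (Pi.single i 1) ^ 2 + l (Pi.single i Complex.I) ^ 2) : ℝ)) := by
  rw [charFunDual_pi]
  simp_rw [charFunDual_complexGaussian]
  rw [← Complex.exp_sum]
  congr 1
  rw [Finset.mul_sum]
  push_cast
  rw [Finset.sum_neg_distrib]
  rfl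

theorem sum_normSq_eq_dotProduct {ι : Type*} [Fintype ι] (b : ι → ℂ) :
    (∑ i, (Complex.normSq (b i) : ℂ)) = dotProduct b (star b) := by
  simp [dotProduct, Complex.mul_conj]

/-- If `A Aᴴ = c`, then `A` maps i.i.d. `CN(0, v)` variables to i.i.d. `CN(0, c v)` variables. -/
theorem map_mulVec_pi_complexGaussian {ι κ : Type*} [Fintype ι] [Fintype κ] [DecidableEq ι]
    [DecidableEq κ] (A : Matrix κ ι ℂ) (v c : ℝ≥0)
    (hA : A * A.conjTranspose = ((c : ℝ) : ℂ) • (1 : Matrix κ κ ℂ)) :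
    (Measure.pi fun _ : ι => complexGaussian v).map (fun w => A.mulVec w) =
      Measure.pi fun _ : κ => complexGaussian (c * v) := by
  set T : (ι → ℂ) →L[ℝ] (κ → ℂ) :=
    ((Matrix.mulVecLin A).restrictScalars ℝ).toContinuousLinearMap with hT
  have hTe : ∀ w, T w = A.mulVec w := fun w => rfl
  have hTf : (fun w => A.mulVec w) = T := rfl
  have := Measure.isProbabilityMeasure_map
    (μ := Measure.pi fun _ : ι => complexGaussian v) (f := T) (by fun_prop)
  rw [hTf]
  apply Measure.ext_of_charFunDual
  ext l
  rw [charFunDual_map, charFunDual_pi_complexGaussian, charFunDual_pi_complexGaussian]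
  congr 3
  -- A real functional is the real part of a complex linear one, here with coefficient vector `a`.
  -- Composing with `A` replaces `a` by `a A`, and `‖a A‖² = a (A Aᴴ) aᴴ = c ‖a‖²`. The
  -- characteristic function sees only this norm.
  set a : κ → ℂ := fun k => ⟨l (Pi.single k 1), -l (Pi.single k Complex.I)⟩ with ha
  have hl : ∀ z : κ → ℂ, l z = (∑ k, a k * z k).re := by
    intro z
    have hz : z = ∑ k, ((z k).re • (Pi.single k 1 : κ → ℂ) +
        (z k).im • (Pi.single k Complex.I : κ → ℂ)) := by
      ext k
      rw [Finset.sum_apply, Finset.sum_eq_single k]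
      · simp
      · intro j _ hj
        simp [hj.symm]
      · simp
    conv_lhs => rw [hz]
    rw [map_sum, Complex.re_sum]
    refine Finset.sum_congr rfl fun k _ => ?_
    rw [map_add, map_smul, map_smul]
    simp [ha]
    ring
  have hcol : ∀ i, (l.comp T) (Pi.single i 1) ^ 2 + (l.comp T) (Pi.single i Complex.I) ^ 2 =
      Complex.normSq (Matrix.vecMul a A i) := by
    intro i
    have h1 : (l.comp T) (Pi.single i 1) = (Matrix.vecMul a A i).re := by
      simp only [ContinuousLinearMap.comp_apply, hTe, hl]
      simp [Matrix.vecMul, dotProduct]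
    have h2 : (l.comp T) (Pi.single i Complex.I) = -(Matrix.vecMul a A i).im := by
      simp only [ContinuousLinearMap.comp_apply, hTe, hl]
      simp only [Matrix.mulVec_single, Matrix.vecMul, dotProduct]
      rw [Complex.im_sum, Complex.re_sum, ← Finset.sum_neg_distrib]
      refine Finset.sum_congr rfl fun k _ => ?_
      simp
      ring
    rw [h1, h2, Complex.normSq_apply]
    ring
  have hrow : ∀ k, l (Pi.single k 1) ^ 2 + l (Pi.single k Complex.I) ^ 2 = Complex.normSq (a k) := by
    intro k
    simp only [ha, Complex.normSq_apply]
    ring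
  simp_rw [hcol, hrow]
  have hmat : (∑ i, (Complex.normSq (Matrix.vecMul a A i) : ℂ)) =
      c * ∑ k, (Complex.normSq (a k) : ℂ) := by
    rw [sum_normSq_eq_dotProduct, sum_normSq_eq_dotProduct, Matrix.star_vecMul, Matrix.dotProduct_mulVec, Matrix.vecMul_vecMul, hA,
      Matrix.vecMul_smul, Matrix.vecMul_one, smul_dotProduct, smul_eq_mul]
  have hreal : ∑ i, Complex.normSq (Matrix.vecMul a A i) = c * ∑ k, Complex.normSq (a k) := by
    exact_mod_cast hmat
  rw [hreal]
  push_cast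
  ring

/-! ### The upper bound on the capacity of the additive Gaussian channel -/

theorem lintegral_pi_prod {ι : Type*} [Fintype ι] {α : ι → Type*}
    [∀ i, MeasurableSpace (α i)] (μ : ∀ i, Measure (α i)) [∀ i, IsProbabilityMeasure (μ i)]
    {f : ∀ i, α i → ℝ≥0∞} (hf : ∀ i, Measurable (f i)) :
    ∫⁻ w, ∏ i, f i (w i) ∂Measure.pi μ = ∏ i, ∫⁻ x, f i x ∂μ i := by
  have hind : iIndepFun (fun i (w : ∀ i, α i) => f i (w i)) (Measure.pi μ) :=
    iIndepFun_pi fun i => (hf i).aemeasurable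
  rw [lintegral_prod_eq_prod_lintegral_of_indepFun Finset.univ _ hind
    (fun i => (hf i).comp (measurable_pi_apply i))]
  refine Finset.prod_congr rfl fun i _ => ?_
  rw [(measurePreserving_eval μ i).lintegral_comp (hf i)]

/-- The log-likelihood ratio between `CN(c, d)` and `CN(0, q)`. -/
noncomputable def tiltExponent (q d : ℝ≥0) (c z : ℂ) : ℝ :=
  Real.log (q / d) + (‖z‖ ^ 2 / q - ‖z - c‖ ^ 2 / d)

theorem measurable_tiltExponent (q d : ℝ≥0) :
    Measurable fun p : ℂ × ℂ => tiltExponent q d p.1 p.2 := by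
  unfold tiltExponent
  fun_prop

theorem exp_tiltExponent {q d : ℝ≥0} (hq : q ≠ 0) (hd : d ≠ 0) (c z : ℂ) :
    Real.exp (tiltExponent q d c z) = q / d * Real.exp (‖z‖ ^ 2 / q - ‖z - c‖ ^ 2 / d) := by
  rw [tiltExponent, Real.exp_add, Real.exp_log]
  have : 0 < q := by positivity
  have : 0 < d := by positivity
  exact div_pos (by assumption_mod_cast) (by assumption_mod_cast)

/-- It suffices to compare both measures on boxes, where density and indicator factor over the
coordinates and `lintegral_complexGaussian_tilt` applies to each factor. -/
theorem pi_complexGaussian_withDensity_tilt {M : ℕ} {q d : ℝ≥0} (hq : q ≠ 0) (hd : d ≠ 0)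
    (c : Fin M → ℂ) :
    ((Measure.pi fun _ : Fin M => complexGaussian q).withDensity fun v =>
      ENNReal.ofReal (Real.exp (∑ m, tiltExponent q d (c m) (v m)))) =
      (Measure.pi fun _ : Fin M => complexGaussian d).map fun w => c + w := by
  have hmap : ((Measure.pi fun _ : Fin M => complexGaussian d).map fun w => c + w) =
      Measure.pi fun m => (complexGaussian d).map fun w => c m + w := by
    have : ∀ m, IsProbabilityMeasure ((complexGaussian d).map fun w => c m + w) :=
      fun m => Measure.isProbabilityMeasure_map (by fun_prop)
    exact Measure.pi_map_pi (f := fun m w => c m + w) (fun m => by fun_prop)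
  have : ∀ m, IsProbabilityMeasure ((complexGaussian d).map fun w => c m + w) :=
    fun m => Measure.isProbabilityMeasure_map (by fun_prop)
  rw [hmap]
  symm
  apply Measure.pi_eq
  intro s hs
  rw [withDensity_apply _ (MeasurableSet.univ_pi hs),
    ← lintegral_indicator (MeasurableSet.univ_pi hs)]
  have hprod : ∀ v : Fin M → ℂ, (Set.univ.pi s).indicator (fun v =>
      ENNReal.ofReal (Real.exp (∑ m, tiltExponent q d (c m) (v m)))) v =
      ∏ m, (ENNReal.ofReal (q / d * Real.exp (‖v m‖ ^ 2 / q - ‖v m - c m‖ ^ 2 / d)) *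
        (s m).indicator 1 (v m)) := by
    intro v
    simp_rw [← exp_tiltExponent hq hd]
    rw [Finset.prod_mul_distrib, ← ENNReal.ofReal_prod_of_nonneg (fun m _ => (Real.exp_pos _).le),
      ← Real.exp_sum]
    by_cases hv : v ∈ Set.univ.pi s
    · rw [Set.indicator_of_mem hv, Finset.prod_eq_one, mul_one]
      intro m _
      rw [Set.indicator_of_mem (hv m (Set.mem_univ m))]
      rfl
    · rw [Set.indicator_of_notMem hv]
      simp only [Set.mem_univ_pi, not_forall] at hv
      obtain ⟨m, hm⟩ := hv
      rw [Finset.prod_eq_zero (Finset.mem_univ m), mul_zero]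
      exact Set.indicator_of_notMem hm _
  simp_rw [hprod]
  have hind : ∀ m, Measurable ((s m).indicator (1 : ℂ → ℝ≥0∞)) :=
    fun m => measurable_one.indicator (hs m)
  rw [lintegral_pi_prod (fun _ => complexGaussian q)
    (f := fun m z => ENNReal.ofReal (q / d * Real.exp (‖z‖ ^ 2 / q - ‖z - c m‖ ^ 2 / d)) *
        (s m).indicator 1 z) (fun m => Measurable.mul (by fun_prop) (hind m))]
  refine Finset.prod_congr rfl fun m _ => ?_
  rw [lintegral_complexGaussian_tilt hq hd _ (hind m),
    ← lintegral_map (hind m) (by fun_prop : Measurable fun z => c m + z),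
    lintegral_indicator_one (hs m)]

/-- Given `x`, the output is a Gaussian vector centred at `x`. Hence the joint law has an explicit
density against the input law times a reference Gaussian, whatever the input law; this makes the
golden formula bound computable. -/
theorem awgn_joint_eq_withDensity {M : ℕ} {q d : ℝ≥0} (hq : q ≠ 0) (hd : d ≠ 0)
    (μ : Measure (Fin M → ℂ)) [IsProbabilityMeasure μ] :
    ((μ.prod (Measure.pi fun _ : Fin M => complexGaussian d)).map fun z => (z.1, z.1 + z.2)) =
      (μ.prod (Measure.pi fun _ : Fin M => complexGaussian q)).withDensity fun z =>
        ENNReal.ofReal (Real.exp (∑ m, tiltExponent q d (z.1 m) (z.2 m))) := by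
  have hT : Measurable fun z : (Fin M → ℂ) × (Fin M → ℂ) =>
      ENNReal.ofReal (Real.exp (∑ m, tiltExponent q d (z.1 m) (z.2 m))) := by
    refine ENNReal.measurable_ofReal.comp (Real.measurable_exp.comp ?_)
    refine Finset.measurable_sum _ fun m _ => ?_
    exact (measurable_tiltExponent q d).comp
      (f := fun z : (Fin M → ℂ) × (Fin M → ℂ) => (z.1 m, z.2 m)) (by fun_prop)
  refine Measure.ext_of_lintegral _ fun f hf => ?_
  rw [lintegral_map hf (by fun_prop), lintegral_withDensity_eq_lintegral_mul _ hT hf,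
    lintegral_prod _ (by fun_prop), lintegral_prod _ (by fun_prop)]
  refine lintegral_congr fun x => ?_
  have hfx : Measurable fun v => f (x, v) := hf.comp measurable_prodMk_left
  have h := lintegral_withDensity_eq_lintegral_mul
    (Measure.pi fun _ : Fin M => complexGaussian q) (hT.comp (measurable_prodMk_left (x := x))) hfx
  simp only [Function.comp_def, Pi.mul_apply] at h ⊢
  rw [← h, pi_complexGaussian_withDensity_tilt hq hd, lintegral_map hfx (by fun_prop)]

theorem lintegral_enorm_add_sq {M : ℕ} (μ : Measure (Fin M → ℂ)) [IsProbabilityMeasure μ]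
    (d : ℝ≥0) (m : Fin M) :
    ∫⁻ z, ‖z.1 m + z.2 m‖ₑ ^ 2 ∂(μ.prod (Measure.pi fun _ : Fin M => complexGaussian d)) =
      ∫⁻ x, ‖x m‖ₑ ^ 2 ∂μ + d := by
  rw [lintegral_prod _ (by fun_prop)]
  have : ∀ x : Fin M → ℂ, ∫⁻ w, ‖x m + w m‖ₑ ^ 2
      ∂(Measure.pi fun _ : Fin M => complexGaussian d) = ‖x m‖ₑ ^ 2 + d := by
    intro x
    rw [(measurePreserving_eval (fun _ : Fin M => complexGaussian d) m).lintegral_comp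
      (f := fun w => ‖x m + w‖ₑ ^ 2) (by fun_prop)]
    simpa using lintegral_enorm_affine_sq_complexGaussian d (x m) 1
  simp_rw [this]
  rw [lintegral_add_right _ measurable_const]
  simp

theorem integrable_norm_sq_of_lintegral {α : Type*} [MeasurableSpace α] {μ : Measure α} {g : α → ℂ}
    (hg : Measurable g) {c : ℝ≥0∞} (h : ∫⁻ x, ‖g x‖ₑ ^ 2 ∂μ = c) (hc : c ≠ ∞) :
    Integrable (fun x => ‖g x‖ ^ 2) μ ∧ ∫ x, ‖g x‖ ^ 2 ∂μ = c.toReal := by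
  have e : ∀ x, ENNReal.ofReal (‖g x‖ ^ 2) = ‖g x‖ₑ ^ 2 := fun x => by
    rw [ENNReal.ofReal_pow (norm_nonneg _), ofReal_norm]
  refine ⟨⟨by fun_prop, ?_⟩, ?_⟩
  · rw [hasFiniteIntegral_iff_ofReal (ae_of_all _ fun x => by positivity)]
    simp_rw [e]
    rw [h]; exact hc.lt_top
  · rw [integral_eq_lintegral_of_nonneg_ae (ae_of_all _ fun x => by positivity) (by fun_prop)]
    simp_rw [e]
    rw [h]

/-- Golden formula with a Gaussian reference law. The expected log-likelihood ratio involves only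
the second moments of the output and of the noise. -/
theorem mutualInfo_awgn_le {M : ℕ} (hM : M ≠ 0) {P : ℝ} (hP : 0 < P)
    (μ : Measure (Fin M → ℂ)) [IsProbabilityMeasure μ] (hμ : PowerConstraint P μ) :
    mutualInfo (μ.prod (awgnNoiseLaw M)) (fun z => z.1) (fun z => awgnOutput M z.1 z.2) ≤
      ENNReal.ofReal (M * Real.log (1 + P / 2)) := by
  have hM' : (0 : ℝ) < M := by positivity
  -- Signal power `P` plus noise power `2`, the variance for which the quadratic terms cancel at
  -- full power.
  set q : ℝ≥0 := ⟨P + 2, by positivity⟩ with hqdef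
  have hqc : (q : ℝ) = P + 2 := rfl
  have hq : q ≠ 0 := by
    rw [← NNReal.coe_ne_zero, hqc]; positivity
  have hpow : ∑ m : Fin M, ∫⁻ x, ‖x m‖ₑ ^ 2 ∂μ ≤ ENNReal.ofReal (M * P) := by
    have h := hμ
    rw [PowerConstraint, ENNReal.div_le_iff (by simpa using hM) (by simp)] at h
    rwa [ENNReal.ofReal_mul hM'.le, mul_comm, ENNReal.ofReal_natCast]
  have hfin : ∀ m, ∫⁻ x, ‖x m‖ₑ ^ 2 ∂μ ≠ ∞ := fun m =>
    ((Finset.single_le_sum (f := fun m : Fin M => ∫⁻ x, ‖x m‖ₑ ^ 2 ∂μ)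
      (fun _ _ => zero_le) (Finset.mem_univ m)).trans hpow).trans_lt
      ENNReal.ofReal_lt_top |>.ne
  set ν := Measure.pi fun _ : Fin M => complexGaussian 2 with hν
  set ρ := Measure.pi fun _ : Fin M => complexGaussian q with hρ
  set J := (μ.prod ν).map fun z => (z.1, z.1 + z.2) with hJ
  have hJp : IsProbabilityMeasure J := Measure.isProbabilityMeasure_map (by fun_prop)
  have hJd : J = _ := awgn_joint_eq_withDensity hq (two_ne_zero) μ
  have hfst : (μ.prod ν).map (fun z => z.1) = μ := Measure.map_fst_prod.trans (by simp)
  have hgold := mutualInfo_le_klDiv_prod (μ := μ.prod ν) (X := fun z => z.1)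
    (Y := fun z => awgnOutput M z.1 z.2) (by fun_prop)
    (by unfold awgnOutput; fun_prop) ρ
  refine hgold.trans ?_
  rw [hfst]
  change klDiv J (μ.prod ρ) ≤ _
  have hV : ∀ m, Integrable (fun z : (Fin M → ℂ) × (Fin M → ℂ) => ‖z.2 m‖ ^ 2) J ∧
      ∫ z, ‖z.2 m‖ ^ 2 ∂J = (∫⁻ x, ‖x m‖ₑ ^ 2 ∂μ).toReal + 2 := by
    intro m
    have h := integrable_norm_sq_of_lintegral (by fun_prop)
      (lintegral_enorm_add_sq μ 2 m) (by simp [hfin m])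
    rw [hJ, integrable_map_measure (by fun_prop) (by fun_prop), integral_map (by fun_prop)
      (by fun_prop)]
    refine ⟨h.1, h.2.trans ?_⟩
    rw [ENNReal.toReal_add (hfin m) (by simp)]
    simp
  have hW : ∀ m, Integrable (fun z : (Fin M → ℂ) × (Fin M → ℂ) => ‖z.2 m - z.1 m‖ ^ 2) J ∧
      ∫ z, ‖z.2 m - z.1 m‖ ^ 2 ∂J = 2 := by
    intro m
    have h1 : ∫⁻ z, ‖z.2 m‖ₑ ^ 2 ∂(μ.prod ν) = 2 := by
      rw [lintegral_prod _ (by fun_prop)]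
      simp only [lintegral_const, measure_univ, mul_one]
      rw [(measurePreserving_eval (fun _ : Fin M => complexGaussian 2) m).lintegral_comp
        (f := fun w => ‖w‖ₑ ^ 2) (by fun_prop), lintegral_enorm_sq_complexGaussian]
      rfl
    have h := integrable_norm_sq_of_lintegral (by fun_prop) h1 (by simp)
    rw [hJ, integrable_map_measure (by fun_prop) (by fun_prop), integral_map (by fun_prop)
      (by fun_prop)]
    simpa [Function.comp_def] using h
  have hterm : ∀ m, Integrable (fun z : (Fin M → ℂ) × (Fin M → ℂ) =>
      tiltExponent q 2 (z.1 m) (z.2 m)) J ∧ ∫ z, tiltExponent q 2 (z.1 m) (z.2 m) ∂J =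
      Real.log (1 + P / 2) + (((∫⁻ x, ‖x m‖ₑ ^ 2 ∂μ).toReal + 2) / (P + 2) - 1) := by
    intro m
    obtain ⟨hV1, hV2⟩ := hV m
    obtain ⟨hW1, hW2⟩ := hW m
    unfold tiltExponent
    have hi : Integrable (fun z : (Fin M → ℂ) × (Fin M → ℂ) => ‖z.2 m‖ ^ 2 / (q : ℝ) -
      ‖z.2 m - z.1 m‖ ^ 2 / ((2 : ℝ≥0) : ℝ)) J := (hV1.div_const _).sub (hW1.div_const _)
    refine ⟨(integrable_const _).add hi, ?_⟩
    rw [integral_add (integrable_const _) hi, integral_sub (hV1.div_const _) (hW1.div_const _),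
      integral_div, integral_div, hV2, hW2, hqc]
    simp only [integral_const, probReal_univ, smul_eq_mul, one_mul, NNReal.coe_ofNat]
    congr 2
    · field_simp; ring
    · norm_num
  have hmeas : Measurable fun z : (Fin M → ℂ) × (Fin M → ℂ) =>
      ∑ m, tiltExponent q 2 (z.1 m) (z.2 m) := by
    refine Finset.measurable_sum _ fun m _ => ?_
    exact (measurable_tiltExponent q 2).comp
      (f := fun z : (Fin M → ℂ) × (Fin M → ℂ) => (z.1 m, z.2 m)) (by fun_prop)
  have hint : Integrable (fun z : (Fin M → ℂ) × (Fin M → ℂ) =>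
      ∑ m, tiltExponent q 2 (z.1 m) (z.2 m)) J := integrable_finsetSum _ fun m _ => (hterm m).1
  have hval : ∫ z, ∑ m, tiltExponent q 2 (z.1 m) (z.2 m) ∂J ≤ M * Real.log (1 + P / 2) := by
    rw [integral_finsetSum _ fun m _ => (hterm m).1]
    simp_rw [(hterm _).2]
    rw [Finset.sum_add_distrib, Finset.sum_sub_distrib, ← Finset.sum_div, Finset.sum_add_distrib,
      ← ENNReal.toReal_sum fun m _ => hfin m]
    have h := ENNReal.toReal_le_of_le_ofReal (by positivity) hpow
    simp only [Finset.sum_const, Finset.card_univ, Fintype.card_fin, nsmul_eq_mul, mul_one]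
    -- Only the total power is constrained, so the quadratic terms cancel after summation over `m`,
    -- not term by term.
    have : ((∑ m : Fin M, ∫⁻ x, ‖x m‖ₑ ^ 2 ∂μ).toReal + M * 2) / (P + 2) ≤ M := by
      rw [div_le_iff₀ (by positivity)]
      linarith
    linarith
  have hkl : klDiv J (μ.prod ρ) = ENNReal.ofReal (∫ z, ∑ m, tiltExponent q 2 (z.1 m) (z.2 m) ∂J) := by
    have h1 : IsProbabilityMeasure ((μ.prod ρ).withDensity fun z =>
        ENNReal.ofReal (Real.exp (∑ m, tiltExponent q 2 (z.1 m) (z.2 m)))) := hJd ▸ hJp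
    have h2 := klDiv_withDensity_ofReal_exp (ν := μ.prod ρ) hmeas (hJd ▸ hint)
    rw [← hJd] at h2
    exact h2
  rw [hkl]
  exact ENNReal.ofReal_le_ofReal hval

theorem blockCapacity_awgn_le {M : ℕ} (hM : M ≠ 0) {P : ℝ} (hP : 0 < P) :
    blockCapacity M P (awgnNoiseLaw M) (awgnOutput M) ≤ ENNReal.ofReal (Real.log (1 + P / 2)) := by
  refine iSup_le fun μ => iSup_le fun _ => iSup_le fun hμ => ?_
  rw [ENNReal.div_le_iff (by simpa using hM) (by simp)]
  refine (mutualInfo_awgn_le hM hP μ hμ).trans_eq ?_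
  rw [mul_comm, ENNReal.ofReal_mul (Real.log_nonneg (by linarith)), ENNReal.ofReal_natCast]

theorem awgnCapacity_le {P : ℝ} (hP : 0 < P) :
    awgnCapacity P ≤ ENNReal.ofReal (Real.log (1 + P / 2)) := by
  refine limsup_le_of_le (by isBoundedDefault) ?_
  filter_upwards [eventually_ne_atTop 0] with M hM
  exact blockCapacity_awgn_le hM hP

/-! ### The phase noise channel as a degraded Gaussian channel -/

/-- Mutual information is a function of the joint law alone, so one realisation of a channel may be
exchanged for another. -/
theorem mutualInfo_congr {Ω Ω' A B : Type*} [MeasurableSpace Ω] [MeasurableSpace Ω']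
    [MeasurableSpace A] [MeasurableSpace B] {μ : Measure Ω} {μ' : Measure Ω'} {X : Ω → A}
    {Y : Ω → B} {X' : Ω' → A} {Y' : Ω' → B} (hX : Measurable X) (hY : Measurable Y)
    (hX' : Measurable X') (hY' : Measurable Y')
    (h : μ.map (fun ω => (X ω, Y ω)) = μ'.map (fun ω => (X' ω, Y' ω))) :
    mutualInfo μ X Y = mutualInfo μ' X' Y' := by
  have h1 : μ.map X = μ'.map X' := by
    have := congrArg (Measure.map Prod.fst) h
    rwa [Measure.map_map measurable_fst (hX.prodMk hY),
      Measure.map_map measurable_fst (hX'.prodMk hY')] at this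
  have h2 : μ.map Y = μ'.map Y' := by
    have := congrArg (Measure.map Prod.snd) h
    rwa [Measure.map_map measurable_snd (hX.prodMk hY),
      Measure.map_map measurable_snd (hX'.prodMk hY')] at this
  rw [mutualInfo, mutualInfo, h, h1, h2]

/-- Data processing: processing the output with independent randomness does not increase the
mutual information. -/
theorem mutualInfo_processing_le {Ω Ω' A A' B B' : Type*} [MeasurableSpace Ω] [MeasurableSpace Ω']
    [MeasurableSpace A] [MeasurableSpace A'] [MeasurableSpace B] [MeasurableSpace B']
    (μ : Measure Ω) [IsProbabilityMeasure μ] (η : Measure Ω') [IsProbabilityMeasure η]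
    {X : Ω → A} {V : Ω → B} {g : A → A'} {G : B × Ω' → B'} (hX : Measurable X) (hV : Measurable V)
    (hg : Measurable g) (hG : Measurable G) :
    mutualInfo (μ.prod η) (fun z => g (X z.1)) (fun z => G (V z.1, z.2)) ≤ mutualInfo μ X V := by
  have := Measure.isProbabilityMeasure_map (μ := μ) hX.aemeasurable
  have := Measure.isProbabilityMeasure_map (μ := μ) hV.aemeasurable
  have := Measure.isProbabilityMeasure_map (μ := μ) (hX.prodMk hV).aemeasurable
  -- The same map carries the joint law times `η` and the product of the marginals times `η` to the
  -- two processed laws. Data processing applies once, and the common factor `η` cancels.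
  set F : (A × B) × Ω' → A' × B' := fun t => (g t.1.1, G (t.1.2, t.2)) with hF
  have hFm : Measurable F := by fun_prop
  have hjoint : (μ.prod η).map (fun z => (g (X z.1), G (V z.1, z.2))) =
      ((μ.map fun ω => (X ω, V ω)).prod η).map F := by
    conv_rhs => rw [← Measure.map_id (μ := η)]
    rw [Measure.map_prod_map _ _ (hX.prodMk hV) measurable_id,
      Measure.map_map hFm (by fun_prop)]
    rfl
  have hXm : (μ.prod η).map (fun z => g (X z.1)) = (μ.map X).map g := by
    rw [Measure.map_map hg hX]
    conv_rhs => rw [← measurePreserving_fst (μ := μ) (ν := η) |>.map_eq]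
    rw [Measure.map_map (by fun_prop) (by fun_prop)]
    rfl
  have hYm : (μ.prod η).map (fun z => G (V z.1, z.2)) = ((μ.map V).prod η).map G := by
    conv_rhs => rw [← Measure.map_id (μ := η)]
    rw [Measure.map_prod_map _ _ hV measurable_id, Measure.map_map hG (by fun_prop)]
    rfl
  have hprod : ((μ.prod η).map (fun z => g (X z.1))).prod
      ((μ.prod η).map (fun z => G (V z.1, z.2))) =
      (((μ.map X).prod (μ.map V)).prod η).map F := by
    rw [hXm, hYm, Measure.map_prod_map _ _ hg hG]
    rw [← (measurePreserving_prodAssoc (μ.map X) (μ.map V) η).map_eq,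
      Measure.map_map (by fun_prop) (by fun_prop)]
    rfl
  rw [mutualInfo, hjoint, hprod, mutualInfo]
  exact (klDiv_map_le _ _ hFm).trans_eq (klDiv_prod_right _ _ η)

theorem sum_mul_index {M L : ℕ} {E : Type*} [AddCommMonoid E] (f : Fin (M * L) → E) :
    ∑ n, f n = ∑ m : Fin M, ∑ l : Fin L, f (finProdFinEquiv (m, l)) := by
  rw [← finProdFinEquiv.sum_comp f, Fintype.sum_prod_type]

@[simp]
theorem divNat_finProdFinEquiv {M L : ℕ} (m : Fin M) (l : Fin L) :
    (finProdFinEquiv (m, l)).divNat = m :=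
  congrArg Prod.fst (finProdFinEquiv.symm_apply_apply (m, l))

theorem sum_filter_divNat {M L : ℕ} {E : Type*} [AddCommMonoid E] (f : Fin (M * L) → E)
    (m : Fin M) :
    ∑ n with n.divNat = m, f n = ∑ l : Fin L, f (finProdFinEquiv (m, l)) := by
  rw [Finset.sum_filter, sum_mul_index, Finset.sum_eq_single m]
  · simp
  · intro b _ hb
    simp [hb]
  · simp

theorem card_filter_divNat {M L : ℕ} (m : Fin M) :
    (Finset.univ.filter fun n : Fin (M * L) => n.divNat = m).card = L := by
  have := sum_filter_divNat (fun _ => 1) m (L := L)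
  simpa using this

/-- The matrix which rebuilds the additive noise of the samples from the noise of the symbol
averages and independent noise. -/
noncomputable def noiseMatrix (M L : ℕ) (c : Fin (M * L) → ℂ) :
    Matrix (Fin (M * L)) (Fin M ⊕ Fin (M * L)) ℂ := Matrix.of fun n =>
  Sum.elim (fun m => c n * if n.divNat = m then ((√L : ℝ) : ℂ)⁻¹ else 0)
    (fun k => c n * ((if n = k then 1 else 0) - if n.divNat = k.divNat then (L : ℂ)⁻¹ else 0))

/-- Let `D = diag(c)` and let `Π` be the projection onto vectors constant on blocks. The two column
groups contribute `D Π Dᴴ` and `D (1 - Π)² Dᴴ = D (1 - Π) Dᴴ`, which add up to `D Dᴴ = 1`. -/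
theorem noiseMatrix_mul_conjTranspose {M L : ℕ} (hL : L ≠ 0) {c : Fin (M * L) → ℂ}
    (hc : ∀ n, c n * (starRingEnd ℂ) (c n) = 1) :
    noiseMatrix M L c * (noiseMatrix M L c).conjTranspose = 1 := by
  have hL' : (L : ℂ) ≠ 0 := by exact_mod_cast hL
  have hs : ((√L : ℝ) : ℂ)⁻¹ * ((√L : ℝ) : ℂ)⁻¹ = (L : ℂ)⁻¹ := by
    rw [← mul_inv, ← Complex.ofReal_mul, Real.mul_self_sqrt (by positivity)]
    simp
  ext n k
  rw [Matrix.mul_apply]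
  simp only [Matrix.conjTranspose_apply, Fintype.sum_sum_type, noiseMatrix, Sum.elim_inl,
    Sum.elim_inr, Matrix.of_apply, RCLike.star_def, map_mul, map_sub, apply_ite (starRingEnd ℂ), map_inv₀,
    Complex.conj_ofReal, map_natCast, map_one, map_zero]
  have h1 : ∑ m : Fin M, (c n * if n.divNat = m then ((√L : ℝ) : ℂ)⁻¹ else 0) *
      ((starRingEnd ℂ) (c k) * if k.divNat = m then ((√L : ℝ) : ℂ)⁻¹ else 0) =
      c n * (starRingEnd ℂ) (c k) * if n.divNat = k.divNat then (L : ℂ)⁻¹ else 0 := by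
    rw [Finset.sum_eq_single n.divNat]
    · by_cases h : n.divNat = k.divNat
      · simp only [h, if_true]
        linear_combination c n * (starRingEnd ℂ) (c k) * hs
      · simp [h, Ne.symm h]
    · intro m _ hm
      simp [hm.symm]
    · simp
  have h2 : ∑ x : Fin (M * L), (c n * ((if n = x then (1 : ℂ) else 0) -
      if n.divNat = x.divNat then (L : ℂ)⁻¹ else 0)) * ((starRingEnd ℂ) (c k) *
      ((if k = x then 1 else 0) - if k.divNat = x.divNat then (L : ℂ)⁻¹ else 0)) =
      c n * (starRingEnd ℂ) (c k) * ((if n = k then 1 else 0) -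
        if n.divNat = k.divNat then (L : ℂ)⁻¹ else 0) := by
    -- Entrywise expansion of `(1 - Π)²`, arranged so that the sum over `x` collapses in each term.
    have e : ∀ x : Fin (M * L), (c n * ((if n = x then (1 : ℂ) else 0) -
        if n.divNat = x.divNat then (L : ℂ)⁻¹ else 0)) * ((starRingEnd ℂ) (c k) *
        ((if k = x then 1 else 0) - if k.divNat = x.divNat then (L : ℂ)⁻¹ else 0)) =
        c n * (starRingEnd ℂ) (c k) * ((if n = x then (if k = x then 1 else 0) -
          (if k.divNat = x.divNat then (L : ℂ)⁻¹ else 0) else 0) -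
          (if k = x then if n.divNat = x.divNat then (L : ℂ)⁻¹ else 0 else 0) +
          if x.divNat = n.divNat then (L : ℂ)⁻¹ *
            (if k.divNat = n.divNat then (L : ℂ)⁻¹ else 0) else 0) := by
      intro x
      by_cases hx : x.divNat = n.divNat
      · simp only [hx, if_true]
        split_ifs <;> ring
      · simp only [hx, Ne.symm hx, if_false]
        split_ifs <;> ring
    simp_rw [e]
    rw [← Finset.mul_sum, Finset.sum_add_distrib, Finset.sum_sub_distrib]
    simp only [Finset.sum_ite_eq, Finset.mem_univ, if_true]
    rw [← Finset.sum_filter, Finset.sum_const, card_filter_divNat, nsmul_eq_mul,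
      mul_inv_cancel_left₀ hL']
    by_cases h : n.divNat = k.divNat
    · simp [h, eq_comm]
    · have hnk : n ≠ k := fun h' => h (by rw [h'])
      simp [h, Ne.symm h, hnk, hnk.symm]
  rw [h1, h2, Matrix.one_apply]
  by_cases hnk : n = k
  · subst hnk
    simp only [if_true]
    linear_combination hc n
  · simp only [hnk, if_false]
    ring

/-- White noise splits into independent block averages and deviations from them. The averages, of
variance `v / L`, may be replaced by independent noise scaled by `1/√L`; unit rotations `c` do not
alter the law. -/
theorem map_noise_decomposition {M L : ℕ} (hL : L ≠ 0) {c : Fin (M * L) → ℂ}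
    (hc : ∀ n, c n * (starRingEnd ℂ) (c n) = 1) (v : ℝ≥0) :
    ((Measure.pi fun _ : Fin M => complexGaussian v).prod
      (Measure.pi fun _ : Fin (M * L) => complexGaussian v)).map
      (fun p n => c n * (((√L : ℝ) : ℂ)⁻¹ * p.1 n.divNat +
        (p.2 n - (L : ℂ)⁻¹ * ∑ k with k.divNat = n.divNat, p.2 k))) =
      Measure.pi fun _ : Fin (M * L) => complexGaussian v := by
  have h := map_mulVec_pi_complexGaussian (noiseMatrix M L c) v 1
    (by rw [noiseMatrix_mul_conjTranspose hL hc]; simp)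
  rw [one_mul] at h
  conv_rhs => rw [← h]
  rw [← (measurePreserving_sumPiEquivProdPi
    (fun _ : Fin M ⊕ Fin (M * L) => complexGaussian v)).map_eq, Measure.map_map
    (by fun_prop) (by fun_prop)]
  congr 1
  ext w n
  simp only [Function.comp_apply, MeasurableEquiv.coe_sumPiEquivProdPi, Equiv.sumPiEquivProdPi,
    Equiv.coe_fn_mk, Matrix.mulVec, dotProduct, Fintype.sum_sum_type, noiseMatrix, Sum.elim_inl,
    Sum.elim_inr, Matrix.of_apply]
  have h1 : ∑ m : Fin M, (c n * if n.divNat = m then ((√L : ℝ) : ℂ)⁻¹ else 0) * w (Sum.inl m) =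
      c n * (((√L : ℝ) : ℂ)⁻¹ * w (Sum.inl n.divNat)) := by
    rw [Finset.sum_eq_single n.divNat]
    · simp [mul_assoc]
    · intro m _ hm
      simp [hm.symm]
    · simp
  rw [h1, mul_add]
  congr 1
  simp_rw [mul_assoc]
  rw [← Finset.mul_sum]
  congr 1
  simp_rw [sub_mul]
  rw [Finset.sum_sub_distrib]
  congr 1
  · simp
  · rw [Finset.sum_filter, Finset.mul_sum]
    refine Finset.sum_congr rfl fun k _ => ?_
    by_cases hk : n.divNat = k.divNat
    · simp [hk]
    · simp [hk, Ne.symm hk]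

instance : IsProbabilityMeasure uniformPhase :=
  cond_isProbabilityMeasure_of_finite (by simp [Real.pi_pos])
    (by rw [Real.volume_Ico]; exact ENNReal.ofReal_ne_top)

instance (M L : ℕ) (σsq : ℝ≥0) : IsProbabilityMeasure (owpnNoiseLaw M L σsq) := by
  unfold owpnNoiseLaw
  infer_instance

instance (M : ℕ) : IsProbabilityMeasure (awgnNoiseLaw M) := by
  unfold awgnNoiseLaw
  infer_instance

@[fun_prop]
theorem measurable_awgnOutput (M : ℕ) :
    Measurable fun z : (Fin M → ℂ) × (Fin M → ℂ) => awgnOutput M z.1 z.2 := by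
  unfold awgnOutput
  fun_prop

@[fun_prop]
theorem measurable_phase {M L : ℕ} (n : Fin (M * L)) :
    Measurable fun ω : OWPNNoise M L => phase ω n := by
  unfold phase
  fun_prop

@[fun_prop]
theorem measurable_owpnOutput (M L : ℕ) :
    Measurable fun z : (Fin M → ℂ) × OWPNNoise M L => owpnOutput M L z.1 z.2 := by
  refine measurable_pi_lambda _ fun n => ?_
  have : Measurable fun z : (Fin M → ℂ) × OWPNNoise M L => phase z.2 n :=
    (measurable_phase n).comp measurable_snd
  unfold owpnOutput
  fun_prop

/-- The output of the phase noise channel rebuilt from the output `v` of a Gaussian channel and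
independent noise. -/
noncomputable def degradedOutput (M L : ℕ) (p : (Fin M → ℂ) × OWPNNoise M L) :
    Fin (M * L) → ℂ :=
  fun n => Complex.exp (Complex.I * (phase p.2 n : ℂ)) * (((√L : ℝ) : ℂ)⁻¹ * p.1 n.divNat +
    (p.2.2.2 n - (L : ℂ)⁻¹ * ∑ k with k.divNat = n.divNat, p.2.2.2 k))

@[fun_prop]
theorem measurable_degradedOutput (M L : ℕ) : Measurable (degradedOutput M L) := by
  refine measurable_pi_lambda _ fun n => ?_
  have : Measurable fun z : (Fin M → ℂ) × OWPNNoise M L => phase z.2 n :=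
    (measurable_phase n).comp measurable_snd
  unfold degradedOutput
  fun_prop

theorem exp_phase_mul_conj (t : ℝ) :
    Complex.exp (Complex.I * (t : ℂ)) * (starRingEnd ℂ) (Complex.exp (Complex.I * (t : ℂ))) = 1 := by
  rw [← Complex.exp_conj, ← Complex.exp_add]
  simp

theorem lintegral_owpnNoiseLaw {M L : ℕ} {σsq : ℝ≥0} {f : OWPNNoise M L → ℝ≥0∞}
    (hf : Measurable f) :
    ∫⁻ ω, f ω ∂owpnNoiseLaw M L σsq = ∫⁻ θ, ∫⁻ N, ∫⁻ W, f (θ, N, W)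
      ∂(Measure.pi fun _ : Fin (M * L) => complexGaussian 2)
      ∂(Measure.pi fun _ : Fin (M * L) => gaussianReal 0 (σsq / L)) ∂uniformPhase := by
  rw [owpnNoiseLaw, lintegral_prod _ hf.aemeasurable]
  refine lintegral_congr fun θ => ?_
  rw [lintegral_prod _ (by fun_prop)]

/-- This identifies the conditional output law of the degraded Gaussian channel, given `x`, with
that of the phase noise channel. -/
theorem lintegral_degradedOutput {M L : ℕ} (hL : L ≠ 0) (σsq : ℝ≥0) (x : Fin M → ℂ)
    {f : (Fin (M * L) → ℂ) → ℝ≥0∞} (hf : Measurable f) :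
    ∫⁻ w, ∫⁻ ω, f (degradedOutput M L (awgnOutput M (fun m => ((√L : ℝ) : ℂ) * x m) w, ω))
      ∂owpnNoiseLaw M L σsq ∂awgnNoiseLaw M =
    ∫⁻ ω, f (owpnOutput M L x ω) ∂owpnNoiseLaw M L σsq := by
  have hs : ((√L : ℝ) : ℂ) ≠ 0 := by
    have : (0 : ℝ) < L := by positivity
    exact_mod_cast (Real.sqrt_pos.2 this).ne'
  have hout : Measurable fun ω => owpnOutput M L x ω :=
    (measurable_owpnOutput M L).comp measurable_prodMk_left
  have hG : Measurable fun p : (Fin M → ℂ) × OWPNNoise M L =>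
      f (degradedOutput M L (awgnOutput M (fun m => ((√L : ℝ) : ℂ) * x m) p.1, p.2)) := by
    refine hf.comp ((measurable_degradedOutput M L).comp ?_)
    unfold awgnOutput
    fun_prop
  -- The phases are brought outermost: once they are frozen the rotations are constants of modulus
  -- one, and the noise decomposition applies.
  rw [lintegral_lintegral_swap hG.aemeasurable,
    lintegral_owpnNoiseLaw (hG.lintegral_prod_left' (μ := awgnNoiseLaw M)),
    lintegral_owpnNoiseLaw (f := fun ω => f (owpnOutput M L x ω)) (hf.comp hout)]
  refine lintegral_congr fun θ => lintegral_congr fun N => ?_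
  set c : Fin (M * L) → ℂ := fun n =>
    Complex.exp (Complex.I * ((θ + ∑ k ∈ Finset.Iic n, N k : ℝ) : ℂ)) with hc
  have hdec := map_noise_decomposition hL (c := c) (fun n => exp_phase_mul_conj _) 2
  have hcx : Measurable fun W : Fin (M * L) → ℂ => f fun n => x n.divNat * c n + W n :=
    hf.comp (by fun_prop)
  have h := lintegral_map (μ := (Measure.pi fun _ : Fin M => complexGaussian 2).prod
    (Measure.pi fun _ : Fin (M * L) => complexGaussian 2)) hcx (g := (fun p n => c n *
      (((√L : ℝ) : ℂ)⁻¹ * p.1 n.divNat + (p.2 n - (L : ℂ)⁻¹ * ∑ k with k.divNat = n.divNat, p.2 k))))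
      (by fun_prop)
  rw [hdec, lintegral_prod_symm _ (by
    apply Measurable.aemeasurable
    exact hcx.comp (g := fun W : Fin (M * L) → ℂ => f fun n => x n.divNat * c n + W n)
      (by fun_prop))] at h
  refine Eq.trans ?_ h.symm
  refine lintegral_congr fun W => lintegral_congr fun w => ?_
  congr 1
  ext n
  simp only [degradedOutput, awgnOutput, phase]
  rw [mul_add (((√L : ℝ) : ℂ)⁻¹), inv_mul_cancel_left₀ hs]
  ring

theorem blockCapacity_owpn_le {L : ℕ} (hL : L ≠ 0) (M : ℕ) (P : ℝ) (σsq : ℝ≥0) :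
    blockCapacity M (P / L) (owpnNoiseLaw M L σsq) (owpnOutput M L) ≤
      blockCapacity M P (awgnNoiseLaw M) (awgnOutput M) := by
  refine iSup_le fun μ => iSup_le fun _ => iSup_le fun hμ => ?_
  have hLr : (0 : ℝ) < L := by positivity
  set s : ℂ := ((√L : ℝ) : ℂ) with hsdef
  have hs : s ≠ 0 := by rw [hsdef]; exact_mod_cast (Real.sqrt_pos.2 hLr).ne'
  have hscale : Measurable fun (x : Fin M → ℂ) m => s * x m := by fun_prop
  -- Amplitude scaling by `√L` raises the power per symbol from `P / L` to `P`; the receiver's map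
  -- `g` undoes it on the input side.
  set μ' := μ.map fun x m => s * x m with hμ'
  have hprob : IsProbabilityMeasure μ' := Measure.isProbabilityMeasure_map hscale.aemeasurable
  have hpow : PowerConstraint P μ' := by
    have hsn : ‖s‖ₑ ^ 2 = (L : ℝ≥0∞) := by
      rw [← ofReal_norm, ← ENNReal.ofReal_pow (norm_nonneg _), hsdef, Complex.norm_real,
        Real.norm_eq_abs, sq_abs, Real.sq_sqrt hLr.le, ENNReal.ofReal_natCast]
    have hm : ∀ m : Fin M, ∫⁻ x, ‖x m‖ₑ ^ 2 ∂μ' = L * ∫⁻ x, ‖x m‖ₑ ^ 2 ∂μ := by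
      intro m
      rw [hμ', lintegral_map (by fun_prop) hscale, ← lintegral_const_mul _ (by fun_prop)]
      simp_rw [enorm_mul, mul_pow, hsn]
    rw [PowerConstraint] at hμ ⊢
    simp_rw [hm]
    rw [← Finset.mul_sum, mul_div_assoc]
    refine (mul_le_mul_right hμ (L : ℝ≥0∞)).trans_eq ?_
    rw [← ENNReal.ofReal_natCast, ← ENNReal.ofReal_mul hLr.le, mul_div_cancel₀ _ hLr.ne']
  refine le_trans ?_ (le_iSup₂_of_le μ' hprob (le_iSup_of_le hpow le_rfl))
  refine ENNReal.div_le_div_right ?_ _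
  have hproc := mutualInfo_processing_le (μ'.prod (awgnNoiseLaw M)) (owpnNoiseLaw M L σsq)
    (X := fun z => z.1) (V := fun z => awgnOutput M z.1 z.2) (g := fun (x : Fin M → ℂ) m => s⁻¹ * x m)
    (G := degradedOutput M L) (by fun_prop) (by fun_prop) (by fun_prop) (by fun_prop)
  refine le_trans (le_of_eq ?_) hproc
  refine mutualInfo_congr (by fun_prop) (by fun_prop) (by fun_prop) (by fun_prop) ?_
  refine Measure.ext_of_lintegral _ fun f hf => ?_
  have hmeas : Measurable fun a : ((Fin M → ℂ) × (Fin M → ℂ)) × OWPNNoise M L =>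
      f ((fun m => s⁻¹ * a.1.1 m), degradedOutput M L (awgnOutput M a.1.1 a.1.2, a.2)) :=
    hf.comp (by fun_prop)
  have hmeas2 : Measurable fun a : (Fin M → ℂ) × (Fin M → ℂ) => ∫⁻ ω,
      f ((fun m => s⁻¹ * a.1 m), degradedOutput M L (awgnOutput M a.1 a.2, ω))
        ∂owpnNoiseLaw M L σsq := hmeas.lintegral_prod_right'
  have hmeas3 : Measurable fun x : Fin M → ℂ => ∫⁻ w, ∫⁻ ω,
      f ((fun m => s⁻¹ * x m), degradedOutput M L (awgnOutput M x w, ω))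
        ∂owpnNoiseLaw M L σsq ∂awgnNoiseLaw M := hmeas2.lintegral_prod_right'
  rw [lintegral_map hf (by fun_prop), lintegral_map hf (by fun_prop),
    lintegral_prod _ (by fun_prop), lintegral_prod _ hmeas.aemeasurable,
    lintegral_prod _ hmeas2.aemeasurable, hμ', lintegral_map hmeas3 hscale]
  refine lintegral_congr fun x => ?_
  have hfx : Measurable fun y => f (x, y) := hf.comp measurable_prodMk_left
  rw [← lintegral_degradedOutput hL σsq x hfx]
  simp_rw [inv_mul_cancel_left₀ hs]
  rfl

theorem owpnCapacity_le_awgnCapacity {L : ℕ} (hL : L ≠ 0) (P : ℝ) (σsq : ℝ≥0) :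
    owpnCapacity P L σsq ≤ awgnCapacity P :=
  limsup_le_limsup (Eventually.of_forall fun M => blockCapacity_owpn_le hL M P σsq)

/-! ### The mean square error of the differential estimator -/

/-- Normalisation of the Gaussian tilt centred at `0`, with `d` chosen so that `1/d = 1/q + t`. -/
theorem lintegral_exp_neg_mul_norm_sq_complexGaussian {q : ℝ≥0} (hq : q ≠ 0) {t : ℝ} (ht : 0 ≤ t) :
    ∫⁻ z, ENNReal.ofReal (Real.exp (-(t * ‖z‖ ^ 2))) ∂complexGaussian q =
      ENNReal.ofReal (1 + t * q)⁻¹ := by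
  have hq' : (0 : ℝ) < q := by positivity
  set d : ℝ≥0 := ⟨q / (1 + t * q), by positivity⟩ with hd
  have hdc : (d : ℝ) = q / (1 + t * q) := rfl
  have hd0 : d ≠ 0 := by
    rw [← NNReal.coe_ne_zero, hdc]; positivity
  have h := lintegral_complexGaussian_tilt_one hq hd0 0
  have e : ∀ z : ℂ, ENNReal.ofReal (q / d * Real.exp (‖z‖ ^ 2 / q - ‖z - 0‖ ^ 2 / d)) =
      ENNReal.ofReal (1 + t * q) * ENNReal.ofReal (Real.exp (-(t * ‖z‖ ^ 2))) := by
    intro z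
    rw [← ENNReal.ofReal_mul (by positivity), hdc, sub_zero]
    congr 2
    · field_simp
    · congr 1
      field_simp
      ring
  simp_rw [e] at h
  rw [lintegral_const_mul _ (by fun_prop)] at h
  rw [ENNReal.ofReal_inv_of_pos (by positivity)]
  exact ENNReal.eq_inv_of_mul_eq_one_left (by rwa [mul_comm])

theorem lintegral_Ioi_inv_one_add_mul_sq {q : ℝ} (hq : 0 < q) :
    ∫⁻ t in Set.Ioi (0 : ℝ), ENNReal.ofReal ((1 + t * q)⁻¹ ^ 2) = ENNReal.ofReal q⁻¹ := by
  have hderiv : ∀ t ∈ Set.Ioi (0 : ℝ),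
      HasDerivAt (fun t : ℝ => -(q⁻¹ * (1 + t * q)⁻¹)) ((1 + t * q)⁻¹ ^ 2) t := by
    intro t ht
    have ht' : (0 : ℝ) < t := ht
    have h1 : HasDerivAt (fun t : ℝ => 1 + t * q) q t := by
      simpa using ((hasDerivAt_id t).mul_const q).const_add 1
    have h2 := ((h1.inv (by positivity)).const_mul q⁻¹).neg
    refine h2.congr_deriv ?_
    field_simp
  have hcont : ContinuousWithinAt (fun t : ℝ => -(q⁻¹ * (1 + t * q)⁻¹)) (Set.Ici 0) 0 := by
    apply ContinuousAt.continuousWithinAt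
    apply ContinuousAt.neg
    apply ContinuousAt.mul continuousAt_const
    exact ContinuousAt.inv₀ (by fun_prop) (by simp)
  have hlim : Tendsto (fun t : ℝ => -(q⁻¹ * (1 + t * q)⁻¹)) atTop (nhds 0) := by
    have h : Tendsto (fun t : ℝ => 1 + t * q) atTop atTop :=
      tendsto_atTop_add_const_left _ _ (tendsto_id.atTop_mul_const hq)
    simpa using (h.inv_tendsto_atTop.const_mul q⁻¹).neg
  have hnn : ∀ t ∈ Set.Ioi (0 : ℝ), 0 ≤ (1 + t * q)⁻¹ ^ 2 := fun t _ => by positivity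
  have hint := integrableOn_Ioi_deriv_of_nonneg hcont hderiv hnn hlim
  have hval := integral_Ioi_of_hasDerivAt_of_nonneg hcont hderiv hnn hlim
  rw [← ofReal_integral_eq_lintegral_ofReal hint
    ((ae_restrict_iff' measurableSet_Ioi).2 (ae_of_all _ hnn)), hval]
  simp

/-- Equality holds for `s > 0`; at `s = 0` both sides are infinite, so vanishing pilots need no
exclusion. -/
theorem ofReal_inv_le_lintegral_exp {s : ℝ} (hs : 0 ≤ s) :
    (ENNReal.ofReal s)⁻¹ ≤ ∫⁻ t in Set.Ioi (0 : ℝ), ENNReal.ofReal (Real.exp (-(t * s))) := by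
  rcases hs.eq_or_lt with rfl | hs
  · simp
  · have hint : IntegrableOn (fun t : ℝ => Real.exp (-(t * s))) (Set.Ioi 0) := by
      simpa [mul_comm] using integrableOn_exp_mul_Ioi (neg_neg_of_pos hs) 0
    rw [← ofReal_integral_eq_lintegral_ofReal hint (ae_of_all _ fun t => (Real.exp_pos _).le),
      ← ENNReal.ofReal_inv_of_pos hs]
    apply ENNReal.ofReal_le_ofReal
    have h := integral_exp_mul_Ioi (neg_neg_of_pos hs) 0
    have e : ∀ t : ℝ, Real.exp (-(t * s)) = Real.exp (-s * t) := fun t => by congr 1; ring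
    simp_rw [e]
    rw [h]
    simp [neg_div_neg_eq]

/-- The expected inverse energy of two independent complex Gaussian variables. -/
theorem lintegral_inv_norm_sq_add_le {q : ℝ≥0} (hq : q ≠ 0) :
    ∫⁻ a, ∫⁻ b, (‖a‖ₑ ^ 2 + ‖b‖ₑ ^ 2)⁻¹ ∂complexGaussian q ∂complexGaussian q ≤
      (q : ℝ≥0∞)⁻¹ := by
  have hq' : (0 : ℝ) < q := by positivity
  have e : ∀ a b : ℂ, (‖a‖ₑ ^ 2 + ‖b‖ₑ ^ 2)⁻¹ ≤ ∫⁻ t in Set.Ioi (0 : ℝ),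
      ENNReal.ofReal (Real.exp (-(t * ‖a‖ ^ 2))) * ENNReal.ofReal (Real.exp (-(t * ‖b‖ ^ 2))) := by
    intro a b
    have h := ofReal_inv_le_lintegral_exp (s := ‖a‖ ^ 2 + ‖b‖ ^ 2) (by positivity)
    rw [ENNReal.ofReal_add (by positivity) (by positivity), ENNReal.ofReal_pow (norm_nonneg _),
      ENNReal.ofReal_pow (norm_nonneg _), ofReal_norm, ofReal_norm] at h
    refine h.trans_eq (lintegral_congr fun t => ?_)
    rw [← ENNReal.ofReal_mul (Real.exp_pos _).le, ← Real.exp_add]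
    congr 2
    ring
  -- Writing the inverse as `∫ exp(-t s) dt` and exchanging integrals gives the square of the
  -- Laplace transform of `|z|²`, namely `(1 + tq)⁻²`. A single Gaussian would leave the
  -- nonintegrable `(1 + tq)⁻¹`.
  calc _ ≤ ∫⁻ a, ∫⁻ b, (∫⁻ t in Set.Ioi (0 : ℝ),
      ENNReal.ofReal (Real.exp (-(t * ‖a‖ ^ 2))) * ENNReal.ofReal (Real.exp (-(t * ‖b‖ ^ 2))))
        ∂complexGaussian q ∂complexGaussian q :=
        lintegral_mono fun a => lintegral_mono fun b => e a b
    _ = ∫⁻ a, (∫⁻ t in Set.Ioi (0 : ℝ), (∫⁻ b,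
      ENNReal.ofReal (Real.exp (-(t * ‖a‖ ^ 2))) * ENNReal.ofReal (Real.exp (-(t * ‖b‖ ^ 2)))
        ∂complexGaussian q)) ∂complexGaussian q := by
        refine lintegral_congr fun a => ?_
        rw [lintegral_lintegral_swap]
        exact Measurable.aemeasurable (by fun_prop)
    _ = ∫⁻ t in Set.Ioi (0 : ℝ), (∫⁻ a, ∫⁻ b,
      ENNReal.ofReal (Real.exp (-(t * ‖a‖ ^ 2))) * ENNReal.ofReal (Real.exp (-(t * ‖b‖ ^ 2)))
        ∂complexGaussian q ∂complexGaussian q) := by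
        rw [lintegral_lintegral_swap]
        apply Measurable.aemeasurable
        apply Measurable.lintegral_prod_right
        fun_prop
    _ = ∫⁻ t in Set.Ioi (0 : ℝ), ENNReal.ofReal ((1 + t * q)⁻¹ ^ 2) := by
        refine setLIntegral_congr_fun measurableSet_Ioi fun t ht => ?_
        have ht' : 0 ≤ t := le_of_lt ht
        simp_rw [lintegral_const_mul _ (show Measurable fun b : ℂ =>
          ENNReal.ofReal (Real.exp (-(t * ‖b‖ ^ 2))) by fun_prop)]
        rw [lintegral_mul_const _ (by fun_prop),
          lintegral_exp_neg_mul_norm_sq_complexGaussian hq ht', ← ENNReal.ofReal_mul (by positivity),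
          sq]
    _ = (q : ℝ≥0∞)⁻¹ := by
        rw [lintegral_Ioi_inv_one_add_mul_sq hq', ENNReal.ofReal_inv_of_pos hq',
          ENNReal.ofReal_coe_nnreal]

theorem lintegral_enorm_affine_conj_sq_complexGaussian (v : ℝ≥0) (α β : ℂ) :
    ∫⁻ z, ‖α + β * (starRingEnd ℂ) z‖ₑ ^ 2 ∂complexGaussian v = ‖α‖ₑ ^ 2 + ‖β‖ₑ ^ 2 * v := by
  have e : ∀ w : ℂ, ‖(starRingEnd ℂ) w‖ₑ = ‖w‖ₑ := fun w => by
    rw [← ofReal_norm, RCLike.norm_conj, ofReal_norm]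
  have h := lintegral_enorm_affine_sq_complexGaussian v ((starRingEnd ℂ) α) ((starRingEnd ℂ) β)
  rw [e, e] at h
  rw [← h]
  refine lintegral_congr fun z => ?_
  rw [← e (α + β * (starRingEnd ℂ) z)]
  simp

theorem lintegral_enorm_affine_conj₂_sq_complexGaussian (v : ℝ≥0) (α β γ : ℂ) :
    ∫⁻ z, ∫⁻ w, ‖α + β * (starRingEnd ℂ) z + γ * (starRingEnd ℂ) w‖ₑ ^ 2
      ∂complexGaussian v ∂complexGaussian v = ‖α‖ₑ ^ 2 + (‖β‖ₑ ^ 2 + ‖γ‖ₑ ^ 2) * v := by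
  simp_rw [lintegral_enorm_affine_conj_sq_complexGaussian]
  rw [lintegral_add_right _ measurable_const, lintegral_enorm_affine_conj_sq_complexGaussian]
  simp
  ring

/-- The phase correction computed from two known symbols `a`, `b` and their observations. -/
noncomputable def phaseCorrection (a b u v : ℂ) : ℂ :=
  (starRingEnd ℂ) (u * (starRingEnd ℂ) a + v * (starRingEnd ℂ) b) / ((‖a‖ ^ 2 + ‖b‖ ^ 2 : ℝ) : ℂ)

theorem measurable_phaseCorrection :
    Measurable fun p : (ℂ × ℂ) × (ℂ × ℂ) => phaseCorrection p.1.1 p.1.2 p.2.1 p.2.2 := by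
  unfold phaseCorrection
  apply Measurable.div
  · exact Complex.continuous_conj.measurable.comp
      (((measurable_fst.comp measurable_snd).mul
        (Complex.continuous_conj.measurable.comp (measurable_fst.comp measurable_fst))).add
      ((measurable_snd.comp measurable_snd).mul
        (Complex.continuous_conj.measurable.comp (measurable_snd.comp measurable_fst))))
  · fun_prop

theorem norm_convex_comb_sq_le {s t : ℝ} (hs : 0 ≤ s) (ht : 0 ≤ t) (hst : s + t = 1) (u w : ℂ) :
    ‖(s : ℂ) * u + t * w‖ ^ 2 ≤ s * ‖u‖ ^ 2 + t * ‖w‖ ^ 2 := by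
  have h : ‖(s : ℂ) * u + t * w‖ ≤ s * ‖u‖ + t * ‖w‖ := by
    refine (norm_add_le _ _).trans_eq ?_
    rw [norm_mul, norm_mul, Complex.norm_of_nonneg hs, Complex.norm_of_nonneg ht]
  have h2 : (s * ‖u‖ + t * ‖w‖) ^ 2 ≤ s * ‖u‖ ^ 2 + t * ‖w‖ ^ 2 := by
    have : t = 1 - s := by linarith
    subst this
    nlinarith [mul_nonneg (mul_nonneg hs ht) (sq_nonneg (‖u‖ - ‖w‖))]
  exact (pow_le_pow_left₀ (norm_nonneg _) h 2).trans h2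

theorem enorm_sq_eq (z : ℂ) : ‖z‖ₑ ^ 2 = ENNReal.ofReal (‖z‖ ^ 2) := by
  rw [ENNReal.ofReal_pow (norm_nonneg _), ofReal_norm]

/-- The mean square error of the estimate of a symbol `c` after phase correction by means of two
known symbols `a`, `b`, given the fading coefficients `α`, `β`, `γ`. -/
theorem lintegral_estimate_error_le {v : ℝ≥0} (hv : v ≠ 0) {a b c α β γ : ℂ} (hα : ‖α‖ ≤ 1) (hβ : ‖β‖ ≤ 1)
    (hγ : ‖γ‖ ≤ 1) :
    ∫⁻ z, ∫⁻ w, ∫⁻ y, ‖c - (c * γ + y) * phaseCorrection a b (a * α + z) (b * β + w)‖ₑ ^ 2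
      ∂complexGaussian v ∂complexGaussian v ∂complexGaussian v ≤
    ‖c‖ₑ ^ 2 * ((‖a‖ₑ ^ 2 * ‖1 - γ * (starRingEnd ℂ) α‖ₑ ^ 2 +
      ‖b‖ₑ ^ 2 * ‖1 - γ * (starRingEnd ℂ) β‖ₑ ^ 2) / (‖a‖ₑ ^ 2 + ‖b‖ₑ ^ 2)) +
      (‖c‖ₑ ^ 2 * v + v * v) * (‖a‖ₑ ^ 2 + ‖b‖ₑ ^ 2)⁻¹ + v := by
  -- If both pilots vanish, the right-hand side is infinite because `v ≠ 0`.
  by_cases hab : ‖a‖ ^ 2 + ‖b‖ ^ 2 = 0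
  · have ha : a = 0 := by
      rw [← norm_eq_zero]; nlinarith [sq_nonneg ‖a‖, sq_nonneg ‖b‖]
    have hb : b = 0 := by
      rw [← norm_eq_zero]; nlinarith [sq_nonneg ‖a‖, sq_nonneg ‖b‖]
    subst ha hb
    simp [hv]
  set S : ℝ := ‖a‖ ^ 2 + ‖b‖ ^ 2 with hS
  have hS0 : 0 < S := lt_of_le_of_ne (by positivity) (Ne.symm hab)
  have hSe : ‖a‖ₑ ^ 2 + ‖b‖ₑ ^ 2 = ENNReal.ofReal S := by
    rw [enorm_sq_eq, enorm_sq_eq, ← ENNReal.ofReal_add (by positivity) (by positivity)]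
  have hSc : (S : ℂ) ≠ 0 := by exact_mod_cast hS0.ne'
  -- The noiseless phase correction: a convex combination of the conjugate fading coefficients,
  -- weighted by pilot energy. Convexity yields both `|g| ≤ 1` and the drift bound `hdrift`.
  set g : ℂ := ((‖a‖ ^ 2 / S : ℝ) : ℂ) * (starRingEnd ℂ) α +
    ((‖b‖ ^ 2 / S : ℝ) : ℂ) * (starRingEnd ℂ) β with hg
  have hsum : ‖a‖ ^ 2 / S + ‖b‖ ^ 2 / S = 1 := by rw [← add_div, ← hS, div_self hS0.ne']
  have hG : ∀ z w : ℂ, phaseCorrection a b (a * α + z) (b * β + w) =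
      g + (a / S) * (starRingEnd ℂ) z + (b / S) * (starRingEnd ℂ) w := by
    intro z w
    have h1 : (a : ℂ) * (starRingEnd ℂ) a = ((‖a‖ ^ 2 : ℝ) : ℂ) := by
      rw [Complex.mul_conj, Complex.normSq_eq_norm_sq]
    have h2 : (b : ℂ) * (starRingEnd ℂ) b = ((‖b‖ ^ 2 : ℝ) : ℂ) := by
      rw [Complex.mul_conj, Complex.normSq_eq_norm_sq]
    rw [phaseCorrection, ← hS, hg]
    simp only [map_add, map_mul, Complex.conj_conj, Complex.ofReal_div]
    field_simp
    rw [← h1, ← h2]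
    ring
  have hab' : ‖a / (S : ℂ)‖ₑ ^ 2 + ‖b / (S : ℂ)‖ₑ ^ 2 = (ENNReal.ofReal S)⁻¹ := by
    rw [enorm_sq_eq, enorm_sq_eq, ← ENNReal.ofReal_add (by positivity) (by positivity),
      ← ENNReal.ofReal_inv_of_pos hS0, norm_div, norm_div, Complex.norm_of_nonneg hS0.le]
    congr 1
    rw [div_pow, div_pow, ← add_div, ← hS]
    field_simp
  have hgn : ‖g‖ₑ ^ 2 ≤ 1 := by
    rw [enorm_sq_eq, ← ENNReal.ofReal_one]
    apply ENNReal.ofReal_le_ofReal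
    refine (norm_convex_comb_sq_le (by positivity) (by positivity) hsum _ _).trans ?_
    rw [RCLike.norm_conj, RCLike.norm_conj, ← hsum]
    have h1 : ‖α‖ ^ 2 ≤ 1 := pow_le_one₀ (norm_nonneg _) hα
    have h2 : ‖β‖ ^ 2 ≤ 1 := pow_le_one₀ (norm_nonneg _) hβ
    gcongr
    · exact mul_le_of_le_one_right (by positivity) h1
    · exact mul_le_of_le_one_right (by positivity) h2
  have hγ2 : ‖γ‖ₑ ^ 2 ≤ 1 := by
    rw [enorm_sq_eq, ← ENNReal.ofReal_one]
    exact ENNReal.ofReal_le_ofReal (pow_le_one₀ (norm_nonneg _) hγ)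
  have hdrift : ‖1 - γ * g‖ₑ ^ 2 ≤ (‖a‖ₑ ^ 2 * ‖1 - γ * (starRingEnd ℂ) α‖ₑ ^ 2 +
      ‖b‖ₑ ^ 2 * ‖1 - γ * (starRingEnd ℂ) β‖ₑ ^ 2) / (‖a‖ₑ ^ 2 + ‖b‖ₑ ^ 2) := by
    have e : 1 - γ * g = ((‖a‖ ^ 2 / S : ℝ) : ℂ) * (1 - γ * (starRingEnd ℂ) α) +
        ((‖b‖ ^ 2 / S : ℝ) : ℂ) * (1 - γ * (starRingEnd ℂ) β) := by
      have hsum' : ((‖a‖ ^ 2 / S : ℝ) : ℂ) + ((‖b‖ ^ 2 / S : ℝ) : ℂ) = 1 := by exact_mod_cast hsum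
      rw [hg]
      linear_combination -hsum'
    rw [hSe, e]
    simp_rw [enorm_sq_eq]
    rw [← ENNReal.ofReal_mul (by positivity), ← ENNReal.ofReal_mul (by positivity),
      ← ENNReal.ofReal_add (by positivity) (by positivity), ← ENNReal.ofReal_div_of_pos hS0]
    apply ENNReal.ofReal_le_ofReal
    refine (norm_convex_comb_sq_le (by positivity) (by positivity) hsum _ _).trans_eq ?_
    ring
  -- The error is affine in the current noise `y`, so its second moment splits. Both remaining terms
  -- are affine in the conjugate pilot noises.
  have hinner : ∀ z w : ℂ,
      ∫⁻ y, ‖c - (c * γ + y) * phaseCorrection a b (a * α + z) (b * β + w)‖ₑ ^ 2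
        ∂complexGaussian v =
      ‖c‖ₑ ^ 2 * ‖(1 - γ * g) + (-(γ * (a / S))) * (starRingEnd ℂ) z +
        (-(γ * (b / S))) * (starRingEnd ℂ) w‖ₑ ^ 2 +
      v * ‖g + (a / S) * (starRingEnd ℂ) z + (b / S) * (starRingEnd ℂ) w‖ₑ ^ 2 := by
    intro z w
    have h := lintegral_enorm_affine_sq_complexGaussian v
      (c * (1 - γ * phaseCorrection a b (a * α + z) (b * β + w)))
      (-phaseCorrection a b (a * α + z) (b * β + w))
    have e : ∀ y, c - (c * γ + y) * phaseCorrection a b (a * α + z) (b * β + w) =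
      c * (1 - γ * phaseCorrection a b (a * α + z) (b * β + w)) +
      -phaseCorrection a b (a * α + z) (b * β + w) * y := fun y => by ring
    simp_rw [e]
    rw [h, hG, enorm_mul, enorm_neg, mul_pow]
    congr 1
    · congr 3
      ring
    · rw [mul_comm]
  simp_rw [hinner]
  have hconj : Measurable (starRingEnd ℂ) := Complex.continuous_conj.measurable
  have hm1 : ∀ z, Measurable fun w => ‖c‖ₑ ^ 2 * ‖(1 - γ * g) + (-(γ * (a / S))) * (starRingEnd ℂ) z +
        (-(γ * (b / S))) * (starRingEnd ℂ) w‖ₑ ^ 2 := fun z =>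
    measurable_const.mul (Measurable.pow_const (Measurable.enorm (measurable_const.add
      (measurable_const.mul hconj))) 2)
  have hm2 : ∀ κ' δ ε : ℂ, Measurable fun z => ∫⁻ w, ‖κ' + δ * (starRingEnd ℂ) z +
        ε * (starRingEnd ℂ) w‖ₑ ^ 2 ∂complexGaussian v := fun κ' δ ε => by
    simp_rw [lintegral_enorm_affine_conj_sq_complexGaussian]
    exact ((Measurable.enorm (measurable_const.add
      (measurable_const.mul hconj))).pow_const 2).add_const _
  have hm3 : ∀ κ' δ ε z : ℂ, Measurable fun w => ‖κ' + δ * (starRingEnd ℂ) z +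
        ε * (starRingEnd ℂ) w‖ₑ ^ 2 := fun κ' δ ε z =>
    (Measurable.enorm (measurable_const.add (measurable_const.mul hconj))).pow_const 2
  simp_rw [fun z => lintegral_add_left (μ := complexGaussian v) (hm1 z), fun z =>
    lintegral_const_mul (μ := complexGaussian v) (‖c‖ₑ ^ 2)
      (hm3 (1 - γ * g) (-(γ * (a / S))) (-(γ * (b / S))) z), fun z =>
    lintegral_const_mul (μ := complexGaussian v) (v : ℝ≥0∞) (hm3 g (a / S) (b / S) z)]
  rw [lintegral_add_left ((hm2 _ _ _).const_mul _), lintegral_const_mul _ (hm2 _ _ _),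
    lintegral_const_mul _ (hm2 _ _ _), lintegral_enorm_affine_conj₂_sq_complexGaussian,
    lintegral_enorm_affine_conj₂_sq_complexGaussian, hab', enorm_neg, enorm_neg, enorm_mul,
    enorm_mul, mul_pow, mul_pow, ← mul_add, hab', ← hSe]
  set I := (‖a‖ₑ ^ 2 + ‖b‖ₑ ^ 2)⁻¹ with hI
  calc ‖c‖ₑ ^ 2 * (‖1 - γ * g‖ₑ ^ 2 + ‖γ‖ₑ ^ 2 * I * v) + v * (‖g‖ₑ ^ 2 + I * v)
      ≤ ‖c‖ₑ ^ 2 * ((‖a‖ₑ ^ 2 * ‖1 - γ * (starRingEnd ℂ) α‖ₑ ^ 2 +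
      ‖b‖ₑ ^ 2 * ‖1 - γ * (starRingEnd ℂ) β‖ₑ ^ 2) / (‖a‖ₑ ^ 2 + ‖b‖ₑ ^ 2) + 1 * I * v) +
        v * (1 + I * v) := by gcongr
    _ = _ := by ring

/-! ### Averages over the samples of a symbol -/

/-- The average of a vector of samples over the samples of symbol `m`. -/
noncomputable def blockMean {M L : ℕ} (y : Fin (M * L) → ℂ) (m : Fin M) : ℂ :=
  (L : ℂ)⁻¹ * ∑ l : Fin L, y (finProdFinEquiv (m, l))

@[fun_prop]
theorem measurable_blockMean {M L : ℕ} (m : Fin M) :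
    Measurable fun y : Fin (M * L) → ℂ => blockMean y m := by
  unfold blockMean
  fun_prop

/-- The average of the phase rotation over the samples of a symbol. -/
noncomputable def fading {M L : ℕ} (ω : OWPNNoise M L) (m : Fin M) : ℂ :=
  blockMean (fun n => Complex.exp (Complex.I * (phase ω n : ℂ))) m

@[fun_prop]
theorem measurable_fading {M L : ℕ} (m : Fin M) :
    Measurable fun ω : OWPNNoise M L => fading ω m := by
  unfold fading blockMean
  fun_prop

theorem blockMean_owpnOutput {M L : ℕ} (x : Fin M → ℂ) (ω : OWPNNoise M L) (m : Fin M) :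
    blockMean (owpnOutput M L x ω) m = x m * fading ω m + blockMean ω.2.2 m := by
  simp only [fading, blockMean, owpnOutput, divNat_finProdFinEquiv, Finset.sum_add_distrib,
    ← Finset.mul_sum]
  ring

theorem norm_fading_le {M L : ℕ} (hL : L ≠ 0) (ω : OWPNNoise M L) (m : Fin M) :
    ‖fading ω m‖ ≤ 1 := by
  have hL' : (0 : ℝ) < L := by positivity
  rw [fading, blockMean, norm_mul, norm_inv, Complex.norm_natCast, inv_mul_le_iff₀ hL', mul_one]
  refine (norm_sum_le _ _).trans ?_
  simp [mul_comm Complex.I, Complex.norm_exp_ofReal_mul_I]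

/-- The left-hand quantity is an average over `L²` sample pairs of `1 - exp(j t)`, with `t` the
phase difference. The bound combines `|exp(j t) - 1| ≤ |t|` with Cauchy-Schwarz. -/
theorem norm_one_sub_fading_sq_le {M L : ℕ} (hL : L ≠ 0) (ω : OWPNNoise M L) (m k : Fin M) :
    ‖1 - fading ω m * (starRingEnd ℂ) (fading ω k)‖ ^ 2 ≤
      ((L : ℝ) ^ 2)⁻¹ * ∑ p : Fin L × Fin L,
        (phase ω (finProdFinEquiv (m, p.1)) - phase ω (finProdFinEquiv (k, p.2))) ^ 2 := by
  have hL' : (L : ℂ) ≠ 0 := by exact_mod_cast hL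
  have hLr : (0 : ℝ) < L := by positivity
  set t : Fin L × Fin L → ℝ := fun p =>
    phase ω (finProdFinEquiv (m, p.1)) - phase ω (finProdFinEquiv (k, p.2)) with ht
  have e : 1 - fading ω m * (starRingEnd ℂ) (fading ω k) =
      -(((L : ℂ) ^ 2)⁻¹ * ∑ p, (Complex.exp (Complex.I * (t p : ℂ)) - 1)) := by
    rw [Finset.sum_sub_distrib]
    simp only [Finset.sum_const, Finset.card_univ, Fintype.card_prod, Fintype.card_fin,
      nsmul_eq_mul, mul_one]
    have : fading ω m * (starRingEnd ℂ) (fading ω k) =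
        ((L : ℂ) ^ 2)⁻¹ * ∑ p, Complex.exp (Complex.I * (t p : ℂ)) := by
      rw [fading, fading, blockMean, blockMean]
      simp only [map_mul, map_inv₀, map_natCast, map_sum]
      rw [mul_mul_mul_comm, Finset.sum_mul_sum, ← Fintype.sum_prod_type', ← mul_inv, ← sq]
      congr 1
      refine Finset.sum_congr rfl fun p _ => ?_
      rw [← Complex.exp_conj, ← Complex.exp_add]
      congr 1
      simp [ht]
      ring
    rw [this]
    push_cast
    field_simp
    ring
  rw [e, norm_neg, norm_mul, norm_inv, norm_pow, Complex.norm_natCast, mul_pow, sq ((_ : ℝ)⁻¹),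
    mul_assoc]
  refine mul_le_mul_of_nonneg_left ?_ (by positivity)
  rw [inv_mul_le_iff₀ (by positivity)]
  calc ‖∑ p, (Complex.exp (Complex.I * (t p : ℂ)) - 1)‖ ^ 2
      ≤ (∑ p, |t p|) ^ 2 := by
        refine pow_le_pow_left₀ (norm_nonneg _) ((norm_sum_le _ _).trans ?_) 2
        exact Finset.sum_le_sum fun p _ => by
          simpa using Real.norm_exp_I_mul_ofReal_sub_one_le (x := t p)
    _ ≤ (Finset.univ : Finset (Fin L × Fin L)).card * ∑ p, |t p| ^ 2 := sq_sum_le_card_mul_sum_sq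
    _ = (L : ℝ) ^ 2 * ∑ p, t p ^ 2 := by
        simp [sq]

theorem lintegral_sum_sq_pi_gaussianReal {ι : Type*} [Fintype ι] (s : Finset ι) (v : ℝ≥0) :
    ∫⁻ N, ENNReal.ofReal ((∑ k ∈ s, N k) ^ 2) ∂(Measure.pi fun _ : ι => gaussianReal 0 v) =
      s.card * v := by
  have hL : ∀ k : ι, MemLp (fun N : ι → ℝ => N k) 2 (Measure.pi fun _ : ι => gaussianReal 0 v) :=
    fun k => (memLp_id_gaussianReal (μ := 0) (v := v) 2).comp_measurePreserving
      (measurePreserving_eval (fun _ : ι => gaussianReal 0 v) k)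
  have hind : iIndepFun (fun k (N : ι → ℝ) => N k) (Measure.pi fun _ : ι => gaussianReal 0 v) :=
    iIndepFun_pi (X := fun _ x => x) fun k => aemeasurable_id
  have hvar := IndepFun.variance_sum (s := s) (X := fun k (N : ι → ℝ) => N k)
    (μ := Measure.pi fun _ : ι => gaussianReal 0 v) (fun k _ => hL k)
    (fun i _ j _ hij => hind.indepFun hij)
  have hv : ∀ k, Var[fun N : ι → ℝ => N k; Measure.pi fun _ : ι => gaussianReal 0 v] = v := by
    intro k
    have h := variance_fun_id_gaussianReal (μ := 0) (v := v)
    have hmp := measurePreserving_eval (fun _ : ι => gaussianReal 0 v) k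
    exact (hmp.variance_fun_comp aemeasurable_id').trans h
  have hmean : ∀ k, ∫ N, N k ∂(Measure.pi fun _ : ι => gaussianReal 0 v) = 0 := by
    intro k
    have h := integral_id_gaussianReal (μ := 0) (v := v)
    rw [← (measurePreserving_eval (fun _ : ι => gaussianReal 0 v) k).map_eq,
      integral_map (measurable_pi_apply k).aemeasurable (by fun_prop)] at h
    exact h
  have hsum : (∑ k ∈ s, fun N : ι → ℝ => N k) = fun N => ∑ k ∈ s, N k := by
    ext N; simp
  simp_rw [hv] at hvar
  rw [hsum, variance_of_integral_eq_zero (by fun_prop) (by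
    rw [integral_finsetSum _ fun k _ => (hL k).integrable (by norm_num)]
    simp [hmean])] at hvar
  have hsq : Integrable (fun N : ι → ℝ => (∑ k ∈ s, N k) ^ 2)
      (Measure.pi fun _ : ι => gaussianReal 0 v) :=
    (memLp_finsetSum s fun k _ => hL k).integrable_sq
  rw [← ofReal_integral_eq_lintegral_ofReal hsq (ae_of_all _ fun N => sq_nonneg _), hvar]
  simp [ENNReal.ofReal_mul]

theorem lintegral_phase_sub_sq {M L : ℕ} (σsq : ℝ≥0) (θ : ℝ) (W : Fin (M * L) → ℂ)
    {n k : Fin (M * L)} (hkn : k ≤ n) :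
    ∫⁻ N, ENNReal.ofReal ((phase ((θ, N, W) : OWPNNoise M L) n -
      phase ((θ, N, W) : OWPNNoise M L) k) ^ 2)
        ∂(Measure.pi fun _ : Fin (M * L) => gaussianReal 0 (σsq / L)) =
      ((n : ℕ) - (k : ℕ) : ℕ) * ((σsq / L : ℝ≥0) : ℝ≥0∞) := by
  -- The initial phase and the common increments cancel, leaving `n - k` independent increments.
  have e : ∀ N : Fin (M * L) → ℝ, phase ((θ, N, W) : OWPNNoise M L) n -
      phase ((θ, N, W) : OWPNNoise M L) k = ∑ i ∈ Finset.Ioc k n, N i := by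
    intro N
    have hdisj : Disjoint (Finset.Iic k) (Finset.Ioc k n) := by
      rw [Finset.disjoint_left]
      intro i hi hi'
      exact absurd (Finset.mem_Iic.1 hi) (not_le.2 (Finset.mem_Ioc.1 hi').1)
    have hunion : Finset.Iic n = Finset.Iic k ∪ Finset.Ioc k n := by
      ext i
      simp only [Finset.mem_Iic, Finset.mem_union, Finset.mem_Ioc]
      constructor
      · intro h
        rcases le_or_gt i k with h' | h'
        · exact Or.inl h'
        · exact Or.inr ⟨h', h⟩
      · rintro (h | h)
        · exact h.trans hkn
        · exact h.2
    simp only [phase]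
    rw [hunion, Finset.sum_union hdisj]
    ring
  simp_rw [e]
  rw [lintegral_sum_sq_pi_gaussianReal, Fin.card_Ioc]

/-- Samples of symbols at distance at most two are fewer than `3L` steps apart, and each step has
variance `σ²/L`; this crude count is the source of the constant `3`. -/
theorem lintegral_one_sub_fading_sq_le {M L : ℕ} (hL : L ≠ 0) (σsq : ℝ≥0) (θ : ℝ)
    (W : Fin (M * L) → ℂ) {m k : Fin M} (hkm : k < m) (hmk : (m : ℕ) ≤ k + 2) :
    ∫⁻ N, ‖1 - fading ((θ, N, W) : OWPNNoise M L) m *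
      (starRingEnd ℂ) (fading ((θ, N, W) : OWPNNoise M L) k)‖ₑ ^ 2
        ∂(Measure.pi fun _ : Fin (M * L) => gaussianReal 0 (σsq / L)) ≤ 3 * σsq := by
  have hLr : (0 : ℝ) < L := by positivity
  have hval : ∀ (m : Fin M) (l : Fin L), ((finProdFinEquiv (m, l) : Fin (M * L)) : ℕ) =
      l + L * m := fun m l => rfl
  have hkm' : (k : ℕ) + 1 ≤ m := hkm
  have hle : ∀ p : Fin L × Fin L, (finProdFinEquiv (k, p.2) : Fin (M * L)) ≤
      finProdFinEquiv (m, p.1) := by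
    intro p
    rw [Fin.le_def, hval, hval]
    have := Nat.mul_le_mul_left L hkm'
    have := p.2.isLt
    rw [mul_add] at *
    omega
  have hsub : ∀ p : Fin L × Fin L, ((finProdFinEquiv (m, p.1) : Fin (M * L)) : ℕ) -
      (finProdFinEquiv (k, p.2) : Fin (M * L)) ≤ 3 * L := by
    intro p
    rw [hval, hval]
    have := Nat.mul_le_mul_left L hmk
    have := p.1.isLt
    rw [mul_add] at *
    omega
  have hm : ∀ p : Fin L × Fin L, Measurable fun N : Fin (M * L) → ℝ =>
      ENNReal.ofReal ((phase ((θ, N, W) : OWPNNoise M L) (finProdFinEquiv (m, p.1)) -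
        phase ((θ, N, W) : OWPNNoise M L) (finProdFinEquiv (k, p.2))) ^ 2) := by
    intro p
    unfold phase
    fun_prop
  calc _ ≤ ∫⁻ N, ENNReal.ofReal ((L : ℝ) ^ 2)⁻¹ * ∑ p : Fin L × Fin L,
        ENNReal.ofReal ((phase ((θ, N, W) : OWPNNoise M L) (finProdFinEquiv (m, p.1)) -
          phase ((θ, N, W) : OWPNNoise M L) (finProdFinEquiv (k, p.2))) ^ 2)
        ∂(Measure.pi fun _ : Fin (M * L) => gaussianReal 0 (σsq / L)) := by
        refine lintegral_mono fun N => ?_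
        rw [enorm_sq_eq, ← ENNReal.ofReal_sum_of_nonneg fun p _ => sq_nonneg _,
          ← ENNReal.ofReal_mul (by positivity)]
        exact ENNReal.ofReal_le_ofReal (norm_one_sub_fading_sq_le hL _ m k)
    _ = ENNReal.ofReal ((L : ℝ) ^ 2)⁻¹ * ∑ p : Fin L × Fin L,
        (((finProdFinEquiv (m, p.1) : Fin (M * L)) : ℕ) -
          ((finProdFinEquiv (k, p.2) : Fin (M * L)) : ℕ) : ℕ) * ((σsq / L : ℝ≥0) : ℝ≥0∞) := by
        rw [lintegral_const_mul _ (Finset.measurable_sum _ fun p _ => hm p),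
          lintegral_finsetSum _ fun p _ => hm p]
        simp_rw [fun p : Fin L × Fin L => lintegral_phase_sub_sq σsq θ W (hle p)]
    _ ≤ ENNReal.ofReal ((L : ℝ) ^ 2)⁻¹ * ∑ _p : Fin L × Fin L,
        ((3 * L : ℕ) : ℝ≥0∞) * ((σsq / L : ℝ≥0) : ℝ≥0∞) := by
        gcongr with p
        exact hsub p
    _ = 3 * σsq := by
        simp only [Finset.sum_const, Finset.card_univ, Fintype.card_prod, Fintype.card_fin,
          nsmul_eq_mul]
        rw [← ENNReal.ofReal_coe_nnreal, ← ENNReal.ofReal_coe_nnreal, ← ENNReal.ofReal_natCast,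
          ← ENNReal.ofReal_natCast, ← ENNReal.ofReal_ofNat, ← ENNReal.ofReal_mul (by positivity),
          ← ENNReal.ofReal_mul (by positivity), ← ENNReal.ofReal_mul (by positivity),
          ← ENNReal.ofReal_mul (by positivity)]
        congr 1
        push_cast
        field_simp

/-! ### Integration of functions of consecutive coordinates -/

theorem lintegral_pi_snoc {n : ℕ} (μ : Measure ℂ) [IsProbabilityMeasure μ]
    {F : (Fin (n + 1) → ℂ) → ℝ≥0∞} (hF : Measurable F) :
    ∫⁻ w, F w ∂(Measure.pi fun _ : Fin (n + 1) => μ) =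
      ∫⁻ w, ∫⁻ a, F (Fin.snoc (α := fun _ => ℂ) w a) ∂μ ∂(Measure.pi fun _ : Fin n => μ) := by
  have hmp := (measurePreserving_piFinSuccAbove (fun _ : Fin (n + 1) => μ) (Fin.last n)).symm
  have hm := hF.comp hmp.measurable
  rw [← hmp.lintegral_comp hF]
  refine (lintegral_prod_symm _ hm.aemeasurable).trans ?_
  refine lintegral_congr fun w => lintegral_congr fun a => ?_
  exact congrArg F (Fin.insertNth_last' _ _)

theorem lintegral_pi_three (μ : Measure ℂ) [IsProbabilityMeasure μ]
    {f : (Fin 3 → ℂ) → ℝ≥0∞} (hf : Measurable f) :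
    ∫⁻ w, f w ∂(Measure.pi fun _ : Fin 3 => μ) =
      ∫⁻ a, ∫⁻ b, ∫⁻ c, f ![a, b, c] ∂μ ∂μ ∂μ := by
  have hm : Measurable fun p : ℂ × ℂ × ℂ => ![p.1, p.2.1, p.2.2] := by
    refine measurable_pi_lambda _ fun i => ?_
    fin_cases i
    · exact measurable_fst
    · exact measurable_fst.comp measurable_snd
    · exact measurable_snd.comp measurable_snd
  have hmap : (Measure.pi fun _ : Fin 3 => μ) =
      (μ.prod (μ.prod μ)).map fun p => ![p.1, p.2.1, p.2.2] := by
    refine Measure.pi_eq fun s hs => ?_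
    have hpre : (fun p : ℂ × ℂ × ℂ => ![p.1, p.2.1, p.2.2]) ⁻¹' Set.univ.pi s =
        s 0 ×ˢ (s 1 ×ˢ s 2) := by
      ext p
      simp [Fin.forall_fin_succ]
    rw [Measure.map_apply hm (MeasurableSet.univ_pi hs), hpre, Measure.prod_prod,
      Measure.prod_prod, Fin.prod_univ_three, mul_assoc]
  rw [hmap, lintegral_map hf hm]
  refine (lintegral_prod _ (hf.comp hm).aemeasurable).trans ?_
  refine lintegral_congr fun a => ?_
  exact lintegral_prod _ ((hf.comp hm).comp measurable_prodMk_left).aemeasurable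

/-- A product of conditional densities, each of which depends on the two previous coordinates,
has total mass at most one. -/
theorem lintegral_prod_consecutive_le (μ : Measure ℂ) [IsProbabilityMeasure μ] {N : ℕ}
    (g : Fin N → ℂ → ℂ → ℂ → ℝ≥0∞)
    (hg : ∀ k, Measurable fun p : (ℂ × ℂ) × ℂ => g k p.1.1 p.1.2 p.2)
    (hg1 : ∀ k a b, ∫⁻ c, g k a b c ∂μ ≤ 1) :
    ∫⁻ x, ∏ k : Fin N, g k (x ⟨k, by omega⟩) (x ⟨k + 1, by omega⟩) (x ⟨k + 2, by omega⟩)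
      ∂(Measure.pi fun _ : Fin (N + 2) => μ) ≤ 1 := by
  induction N with
  | zero => simp
  | succ N ih =>
    have hgm : ∀ {n : ℕ} (k : Fin (N + 1)) (i j l : Fin n), Measurable fun x : Fin n → ℂ =>
        g k (x i) (x j) (x l) := fun k i j l =>
      (hg k).comp (f := fun x : Fin _ → ℂ => ((x i, x j), x l)) (by fun_prop)
    rw [lintegral_pi_snoc (n := N + 2) μ (Finset.measurable_prod _ fun k _ => hgm _ _ _ _)]
    -- Only the last factor involves the last coordinate. Integrating that coordinate out first
    -- costs a factor at most one and leaves the same statement for `N`.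
    refine le_trans (lintegral_mono fun w => ?_) (ih (fun k => g k.castSucc)
      (fun k => hg _) fun k => hg1 _)
    simp_rw [Fin.prod_univ_castSucc]
    have h : ∀ a : ℂ, ∀ i : ℕ, ∀ hi : i < N + 2, Fin.snoc (α := fun _ => ℂ) w a ⟨i, by omega⟩ =
        w ⟨i, hi⟩ := by
      intro a i hi
      simp [Fin.snoc, hi]
    have hlast : ∀ a : ℂ, Fin.snoc (α := fun _ => ℂ) w a ⟨N + 2, by omega⟩ = a := by
      intro a
      simp [Fin.snoc]
    have e : ∀ a : ℂ, (∏ k : Fin N, g k.castSucc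
        (Fin.snoc (α := fun _ => ℂ) w a ⟨(k.castSucc : Fin (N + 1)), by omega⟩)
        (Fin.snoc (α := fun _ => ℂ) w a ⟨(k.castSucc : Fin (N + 1)) + 1, by omega⟩)
        (Fin.snoc (α := fun _ => ℂ) w a ⟨(k.castSucc : Fin (N + 1)) + 2, by omega⟩)) =
        ∏ k : Fin N, g k.castSucc
          (w ⟨k, by omega⟩) (w ⟨k + 1, by omega⟩) (w ⟨k + 2, by omega⟩) := by
      intro a
      refine Finset.prod_congr rfl fun k _ => ?_
      simp only [Fin.val_castSucc]
      rw [h a k (by omega), h a (k + 1) (by omega), h a (k + 2) (by omega)]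
    have e2 : ∀ a : ℂ, g (Fin.last N)
        (Fin.snoc (α := fun _ => ℂ) w a ⟨(Fin.last N : Fin (N + 1)), by simp⟩)
        (Fin.snoc (α := fun _ => ℂ) w a ⟨(Fin.last N : Fin (N + 1)) + 1, by simp⟩)
        (Fin.snoc (α := fun _ => ℂ) w a ⟨(Fin.last N : Fin (N + 1)) + 2, by simp⟩) =
        g (Fin.last N) (w ⟨N, by omega⟩) (w ⟨N + 1, by omega⟩) a := by
      intro a
      simp only [Fin.val_last]
      rw [h a N (by omega), h a (N + 1) (by omega), hlast]
    simp_rw [e, e2]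
    have hgN : Measurable fun a => g (Fin.last N) (w ⟨N, by omega⟩) (w ⟨N + 1, by omega⟩) a :=
      (hg _).comp (f := fun a : ℂ => ((w ⟨N, by omega⟩, w ⟨N + 1, by omega⟩), a)) (by fun_prop)
    rw [lintegral_const_mul _ hgN]
    exact mul_le_of_le_one_right' (hg1 _ _ _)

/-! ### The mean square error over the channel -/

/-- The averaging rows of distinct symbols have disjoint supports and squared norm `1 / L`. -/
theorem map_blockMean {M L : ℕ} (hL : L ≠ 0) {e : Fin 3 → Fin M} (he : Function.Injective e)
    (v : ℝ≥0) :
    (Measure.pi fun _ : Fin (M * L) => complexGaussian v).map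
      (fun W k => blockMean W (e k)) = Measure.pi fun _ : Fin 3 => complexGaussian (v / L) := by
  have hL' : (L : ℂ) ≠ 0 := by exact_mod_cast hL
  have h := map_mulVec_pi_complexGaussian
    (Matrix.of fun (k : Fin 3) (n : Fin (M * L)) => if n.divNat = e k then (L : ℂ)⁻¹ else 0)
    v (L : ℝ≥0)⁻¹ (by
      ext k k'
      rw [Matrix.mul_apply]
      simp only [Matrix.conjTranspose_apply, Matrix.of_apply, RCLike.star_def,
        apply_ite (starRingEnd ℂ), map_inv₀, map_natCast, map_zero, ite_mul, zero_mul]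
      rw [← Finset.sum_filter, sum_filter_divNat]
      simp only [divNat_finProdFinEquiv, he.eq_iff]
      by_cases hk : k = k'
      · subst hk
        simp
        field_simp
      · simp [hk])
  rw [div_eq_inv_mul, ← h]
  congr 1
  ext W k
  simp only [Matrix.mulVec, dotProduct, Matrix.of_apply, ite_mul, zero_mul]
  rw [← Finset.sum_filter, sum_filter_divNat, ← Finset.mul_sum, blockMean]

theorem map_select {M : ℕ} {e : Fin 3 → Fin M} (he : Function.Injective e) (v : ℝ≥0) :
    (Measure.pi fun _ : Fin M => complexGaussian v).map (fun x k => x (e k)) =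
      Measure.pi fun _ : Fin 3 => complexGaussian v := by
  have h := map_mulVec_pi_complexGaussian
    (Matrix.of fun (k : Fin 3) (n : Fin M) => if n = e k then (1 : ℂ) else 0) v 1 (by
      ext k k'
      rw [Matrix.mul_apply]
      simp [Matrix.one_apply, he.eq_iff, eq_comm])
  rw [one_mul] at h
  rw [← h]
  congr 1
  ext W k
  simp [Matrix.mulVec, dotProduct]

theorem injective_vecCons_three {M : ℕ} {i j l : Fin M} (hij : i < j) (hjl : j < l) :
    Function.Injective ![i, j, l] := by
  have := hij.trans hjl
  intro a b hab
  fin_cases a <;> fin_cases b <;> simp_all [hij.ne, hij.ne', hjl.ne, hjl.ne', this.ne, this.ne']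

/-- The estimate of symbol `l` from the output, when the symbols `i` and `j` are known. -/
noncomputable def symbolEstimate {M L : ℕ} (i j l : Fin M) (a b : ℂ) (y : Fin (M * L) → ℂ) : ℂ :=
  blockMean y l * phaseCorrection a b (blockMean y i) (blockMean y j)

theorem measurable_symbolEstimate {M L : ℕ} (i j l : Fin M) :
    Measurable fun p : (ℂ × ℂ) × (Fin (M * L) → ℂ) => symbolEstimate i j l p.1.1 p.1.2 p.2 := by
  have h : Measurable fun p : (ℂ × ℂ) × (Fin (M * L) → ℂ) =>
      phaseCorrection p.1.1 p.1.2 (blockMean p.2 i) (blockMean p.2 j) :=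
    measurable_phaseCorrection.comp (f := fun p : (ℂ × ℂ) × (Fin (M * L) → ℂ) =>
      (p.1, (blockMean p.2 i, blockMean p.2 j))) (by fun_prop)
  unfold symbolEstimate
  fun_prop

theorem measurable_symbolEstimate_error {M L : ℕ} (i j l : Fin M) :
    Measurable fun z : (Fin M → ℂ) × OWPNNoise M L =>
      z.1 l - symbolEstimate i j l (z.1 i) (z.1 j) (owpnOutput M L z.1 z.2) := by
  have h : Measurable fun z : (Fin M → ℂ) × OWPNNoise M L =>
      symbolEstimate i j l (z.1 i) (z.1 j) (owpnOutput M L z.1 z.2) :=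
    (measurable_symbolEstimate i j l).comp (f := fun z : (Fin M → ℂ) × OWPNNoise M L =>
      ((z.1 i, z.1 j), owpnOutput M L z.1 z.2)) (by fun_prop)
  fun_prop

/-- Conditionally on the input, the additive noise is integrated first, with phases frozen, and then
the phase increments. The drift bound is uniform in `θ`. -/
theorem lintegral_symbolEstimate_error_noise_le {M L : ℕ} (hL : L ≠ 0) (σsq : ℝ≥0)
    {i j l : Fin M} (hij : i < j) (hjl : j < l) (hli : (l : ℕ) ≤ i + 2) (x : Fin M → ℂ) :
    ∫⁻ ω, ‖x l - symbolEstimate i j l (x i) (x j) (owpnOutput M L x ω)‖ₑ ^ 2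
      ∂owpnNoiseLaw M L σsq ≤
      ‖x l‖ₑ ^ 2 * (3 * σsq) + (‖x l‖ₑ ^ 2 * (2 / L : ℝ≥0) +
        (2 / L : ℝ≥0) * (2 / L : ℝ≥0)) * (‖x i‖ₑ ^ 2 + ‖x j‖ₑ ^ 2)⁻¹ + (2 / L : ℝ≥0) := by
  have hv : (2 / L : ℝ≥0) ≠ 0 := by positivity
  set v : ℝ≥0 := 2 / L with hvdef
  have hest := measurable_symbolEstimate (L := L) i j l
  have hmeas : Measurable fun ω : OWPNNoise M L =>
      ‖x l - symbolEstimate i j l (x i) (x j) (owpnOutput M L x ω)‖ₑ ^ 2 := by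
    have h1 : Measurable fun ω : OWPNNoise M L => owpnOutput M L x ω :=
      (measurable_owpnOutput M L).comp measurable_prodMk_left
    have h2 : Measurable fun ω : OWPNNoise M L =>
        symbolEstimate i j l (x i) (x j) (owpnOutput M L x ω) :=
      hest.comp (f := fun ω => ((x i, x j), owpnOutput M L x ω)) (by fun_prop)
    fun_prop
  rw [lintegral_owpnNoiseLaw hmeas]
  set S := ‖x i‖ₑ ^ 2 + ‖x j‖ₑ ^ 2 with hS
  set C := (‖x l‖ₑ ^ 2 * v + v * v) * S⁻¹ + (v : ℝ≥0∞) with hC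
  set α : ℝ → (Fin (M * L) → ℝ) → Fin M → ℂ := fun θ N m =>
    fading ((θ, N, 0) : OWPNNoise M L) m with hα
  have hW : ∀ θ N, ∫⁻ W, ‖x l - symbolEstimate i j l (x i) (x j)
      (owpnOutput M L x (θ, N, W))‖ₑ ^ 2
      ∂(Measure.pi fun _ : Fin (M * L) => complexGaussian 2) ≤
      ‖x l‖ₑ ^ 2 * ((‖x i‖ₑ ^ 2 * ‖1 - α θ N l * (starRingEnd ℂ) (α θ N i)‖ₑ ^ 2 +
        ‖x j‖ₑ ^ 2 * ‖1 - α θ N l * (starRingEnd ℂ) (α θ N j)‖ₑ ^ 2) * S⁻¹) + C := by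
    intro θ N
    set F : (Fin 3 → ℂ) → ℝ≥0∞ := fun t => ‖x l - (x l * α θ N l + t 2) *
      phaseCorrection (x i) (x j) (x i * α θ N i + t 0) (x j * α θ N j + t 1)‖ₑ ^ 2 with hF
    have hFm : Measurable F := by
      have h1 : Measurable fun t : Fin 3 → ℂ =>
          phaseCorrection (x i) (x j) (x i * α θ N i + t 0) (x j * α θ N j + t 1) :=
        measurable_phaseCorrection.comp (f := fun t : Fin 3 → ℂ =>
          ((x i, x j), (x i * α θ N i + t 0, x j * α θ N j + t 1))) (by fun_prop)
      fun_prop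
    have e : ∀ W, ‖x l - symbolEstimate i j l (x i) (x j) (owpnOutput M L x (θ, N, W))‖ₑ ^ 2 =
        F (fun k => blockMean W (![i, j, l] k)) := by
      intro W
      simp only [symbolEstimate, blockMean_owpnOutput]
      rfl
    simp_rw [e]
    rw [← lintegral_map hFm (g := fun W k => blockMean W (![i, j, l] k)) (by fun_prop),
      map_blockMean hL (injective_vecCons_three hij hjl), lintegral_pi_three _ hFm]
    refine (lintegral_estimate_error_le hv (norm_fading_le hL _ _) (norm_fading_le hL _ _)
      (norm_fading_le hL _ _)).trans_eq ?_
    rw [hC, ← add_assoc]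
    rfl
  have hαm : ∀ θ (k : Fin M), Measurable fun N : Fin (M * L) → ℝ =>
      ‖1 - α θ N l * (starRingEnd ℂ) (α θ N k)‖ₑ ^ 2 := by
    intro θ k
    have h1 : ∀ k : Fin M, Measurable fun N : Fin (M * L) → ℝ => α θ N k := fun k =>
      (measurable_fading k).comp (f := fun N => ((θ, N, 0) : OWPNNoise M L)) (by fun_prop)
    exact (measurable_const.sub ((h1 l).mul
      (Complex.continuous_conj.measurable.comp (h1 k)))).enorm.pow_const 2
  have hN : ∀ θ, ∫⁻ N, ∫⁻ W, ‖x l - symbolEstimate i j l (x i) (x j)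
      (owpnOutput M L x (θ, N, W))‖ₑ ^ 2
      ∂(Measure.pi fun _ : Fin (M * L) => complexGaussian 2)
      ∂(Measure.pi fun _ : Fin (M * L) => gaussianReal 0 (σsq / L)) ≤
      ‖x l‖ₑ ^ 2 * (3 * σsq) + C := by
    intro θ
    refine (lintegral_mono (hW θ)).trans ?_
    have hfg : Measurable fun N => ‖x i‖ₑ ^ 2 * ‖1 - α θ N l * (starRingEnd ℂ) (α θ N i)‖ₑ ^ 2 +
        ‖x j‖ₑ ^ 2 * ‖1 - α θ N l * (starRingEnd ℂ) (α θ N j)‖ₑ ^ 2 :=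
      ((hαm θ i).const_mul _).add ((hαm θ j).const_mul _)
    rw [lintegral_add_right _ measurable_const, lintegral_const_mul _ (hfg.mul_const _),
      lintegral_mul_const _ hfg,
      lintegral_add_left ((hαm θ i).const_mul _), lintegral_const_mul _ (hαm θ i),
      lintegral_const_mul _ (hαm θ j), lintegral_const, measure_univ, mul_one]
    refine add_le_add (mul_le_mul' le_rfl ?_) le_rfl
    have hi := lintegral_one_sub_fading_sq_le hL σsq θ 0 (hij.trans hjl) hli
    have hj := lintegral_one_sub_fading_sq_le hL σsq θ 0 hjl
      (by have : (i : ℕ) < j := hij; omega)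
    calc _ ≤ (‖x i‖ₑ ^ 2 * (3 * σsq) + ‖x j‖ₑ ^ 2 * (3 * σsq)) * S⁻¹ :=
          mul_le_mul' (add_le_add (mul_le_mul' le_rfl hi) (mul_le_mul' le_rfl hj)) le_rfl
      _ = (S / S) * (3 * σsq) := by rw [← add_mul, ← hS, div_eq_mul_inv]; ring
      -- The energy weights sum to at most one, also when `S = 0`.
      _ ≤ 1 * (3 * σsq) := mul_le_mul' ENNReal.div_self_le_one le_rfl
      _ = 3 * σsq := one_mul _
  refine (lintegral_mono hN).trans_eq ?_
  rw [lintegral_const, measure_univ, mul_one, hC, ← add_assoc]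

/-- Under i.i.d. inputs the current symbol, of energy `q`, is independent of the pilots, whose
expected inverse energy is at most `1 / q`. -/
theorem lintegral_symbolEstimate_error_le {M L : ℕ} (hL : L ≠ 0) (σsq : ℝ≥0) {q : ℝ≥0}
    (hq : q ≠ 0) {i j l : Fin M} (hij : i < j) (hjl : j < l) (hli : (l : ℕ) ≤ i + 2) :
    ∫⁻ z, ‖z.1 l - symbolEstimate i j l (z.1 i) (z.1 j) (owpnOutput M L z.1 z.2)‖ₑ ^ 2
      ∂((Measure.pi fun _ : Fin M => complexGaussian q).prod (owpnNoiseLaw M L σsq)) ≤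
      ((q * (3 * σsq) + (q * (2 / L) + (2 / L) * (2 / L)) * q⁻¹ + 2 / L : ℝ≥0) : ℝ≥0∞) := by
  set v : ℝ≥0 := 2 / L with hvdef
  have hmeas := measurable_symbolEstimate_error (L := L) i j l
  rw [lintegral_prod _ ((hmeas.enorm.pow_const 2).aemeasurable)]
  set F : (Fin 3 → ℂ) → ℝ≥0∞ := fun t => ‖t 2‖ₑ ^ 2 * (3 * σsq) +
    (‖t 2‖ₑ ^ 2 * v + v * v) * (‖t 0‖ₑ ^ 2 + ‖t 1‖ₑ ^ 2)⁻¹ + v with hF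
  have hFm : Measurable F := by fun_prop
  have hF1 : ∀ x : Fin M → ℂ, ∫⁻ ω,
      ‖x l - symbolEstimate i j l (x i) (x j) (owpnOutput M L x ω)‖ₑ ^ 2 ∂owpnNoiseLaw M L σsq ≤
      F (fun k => x (![i, j, l] k)) :=
    fun x => lintegral_symbolEstimate_error_noise_le hL σsq hij hjl hli x
  refine (lintegral_mono hF1).trans ?_
  rw [← lintegral_map hFm (g := fun (x : Fin M → ℂ) k => x (![i, j, l] k)) (by fun_prop),
    map_select (injective_vecCons_three hij hjl), lintegral_pi_three _ hFm]
  have hin : ∀ a b : ℂ, ∫⁻ c, F ![a, b, c] ∂complexGaussian q =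
      (q * v + v * v) * (‖a‖ₑ ^ 2 + ‖b‖ₑ ^ 2)⁻¹ + (q * (3 * σsq) + v) := by
    intro a b
    change ∫⁻ c, ‖c‖ₑ ^ 2 * (3 * σsq) + (‖c‖ₑ ^ 2 * v + v * v) *
      (‖a‖ₑ ^ 2 + ‖b‖ₑ ^ 2)⁻¹ + v ∂complexGaussian q = _
    rw [lintegral_add_right _ measurable_const, lintegral_add_left (by fun_prop),
      lintegral_mul_const _ (by fun_prop), lintegral_mul_const _ (by fun_prop),
      lintegral_add_right _ measurable_const, lintegral_mul_const _ (by fun_prop),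
      lintegral_enorm_sq_complexGaussian]
    simp only [lintegral_const, measure_univ, mul_one]
    ring
  simp_rw [hin]
  have h1 : ∀ a : ℂ, ∫⁻ b, ((q : ℝ≥0∞) * v + v * v) * (‖a‖ₑ ^ 2 + ‖b‖ₑ ^ 2)⁻¹ +
      (q * (3 * σsq) + v) ∂complexGaussian q =
      (q * v + v * v) * ∫⁻ b, (‖a‖ₑ ^ 2 + ‖b‖ₑ ^ 2)⁻¹ ∂complexGaussian q +
      (q * (3 * σsq) + v) := by
    intro a
    rw [lintegral_add_right _ measurable_const, lintegral_const_mul _ (by fun_prop)]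
    simp
  simp_rw [h1]
  have h2 : Measurable fun a : ℂ => ∫⁻ b, (‖a‖ₑ ^ 2 + ‖b‖ₑ ^ 2)⁻¹ ∂complexGaussian q := by
    apply Measurable.lintegral_prod_right
    fun_prop
  rw [lintegral_add_right _ measurable_const, lintegral_const_mul _ h2, lintegral_const,
    measure_univ, mul_one]
  push_cast [ENNReal.coe_inv hq]
  calc _ ≤ ((q : ℝ≥0∞) * v + v * v) * (q : ℝ≥0∞)⁻¹ + (q * (3 * σsq) + v) := by
        gcongr
        exact lintegral_inv_norm_sq_add_le hq
    _ = _ := by ring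

/-! ### The lower bound on the capacity of the phase noise channel -/

theorem measurable_tiltExponent_symbolEstimate {M L : ℕ} (q d : ℝ≥0) (i j l : Fin M) :
    Measurable fun p : (Fin M → ℂ) × (Fin (M * L) → ℂ) =>
      tiltExponent q d (symbolEstimate i j l (p.1 i) (p.1 j) p.2) (p.1 l) := by
  have h : Measurable fun p : (Fin M → ℂ) × (Fin (M * L) → ℂ) =>
      symbolEstimate i j l (p.1 i) (p.1 j) p.2 :=
    (measurable_symbolEstimate i j l).comp
      (f := fun p : (Fin M → ℂ) × (Fin (M * L) → ℂ) => ((p.1 i, p.1 j), p.2)) (by fun_prop)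
  have hl : Measurable fun p : (Fin M → ℂ) × (Fin (M * L) → ℂ) => p.1 l := by fun_prop
  unfold tiltExponent
  fun_prop

/-- The mean exponent is `log (q / d) + 𝔼|X|²/q - 𝔼|error|²/d`. The middle term is `1` and the last
ratio is at most `1`. -/
theorem log_le_integral_tiltExponent_symbolEstimate {M L : ℕ} (hL : L ≠ 0) (σsq : ℝ≥0) {q d : ℝ≥0}
    (hq : q ≠ 0) (hd : d ≠ 0)
    (hqd : q * (3 * σsq) + (q * (2 / L) + (2 / L) * (2 / L)) * q⁻¹ + 2 / L ≤ d)
    {i j l : Fin M} (hij : i < j) (hjl : j < l) (hli : (l : ℕ) ≤ i + 2) :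
    Integrable (fun z : (Fin M → ℂ) × OWPNNoise M L => tiltExponent q d
      (symbolEstimate i j l (z.1 i) (z.1 j) (owpnOutput M L z.1 z.2)) (z.1 l))
      ((Measure.pi fun _ : Fin M => complexGaussian q).prod (owpnNoiseLaw M L σsq)) ∧
    Real.log (q / d) ≤ ∫ z, tiltExponent q d
      (symbolEstimate i j l (z.1 i) (z.1 j) (owpnOutput M L z.1 z.2)) (z.1 l)
      ∂((Measure.pi fun _ : Fin M => complexGaussian q).prod (owpnNoiseLaw M L σsq)) := by
  have hq' : (0 : ℝ) < q := by positivity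
  have hd' : (0 : ℝ) < d := by positivity
  set ξ := (Measure.pi fun _ : Fin M => complexGaussian q).prod (owpnNoiseLaw M L σsq) with hξ
  have hin : ∫⁻ z, ‖z.1 l‖ₑ ^ 2 ∂ξ = q := by
    rw [hξ, lintegral_prod _ (by fun_prop)]
    simp only [lintegral_const, measure_univ, mul_one]
    rw [(measurePreserving_eval (fun _ : Fin M => complexGaussian q) _).lintegral_comp
      (f := fun w => ‖w‖ₑ ^ 2) (by fun_prop), lintegral_enorm_sq_complexGaussian]
  obtain ⟨hi1, hi2⟩ := integrable_norm_sq_of_lintegral (by fun_prop) hin (by simp)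
  have herr := (lintegral_symbolEstimate_error_le hL σsq hq hij hjl hli).trans
    (ENNReal.coe_le_coe.2 hqd)
  obtain ⟨he1, he2⟩ := integrable_norm_sq_of_lintegral
    (measurable_symbolEstimate_error _ _ _) rfl (herr.trans_lt ENNReal.coe_lt_top).ne
  have he3 := ENNReal.toReal_mono ENNReal.coe_ne_top herr
  rw [← he2, ENNReal.coe_toReal] at he3
  have hi : Integrable (fun z : (Fin M → ℂ) × OWPNNoise M L => ‖z.1 l‖ ^ 2 / (q : ℝ) -
      ‖z.1 l - symbolEstimate i j l (z.1 i) (z.1 j) (owpnOutput M L z.1 z.2)‖ ^ 2 / (d : ℝ)) ξ :=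
    (hi1.div_const (q : ℝ)).sub (he1.div_const (d : ℝ))
  unfold tiltExponent
  refine ⟨(integrable_const _).add hi, ?_⟩
  rw [integral_add (integrable_const _) hi, integral_sub (hi1.div_const _) (he1.div_const _),
    integral_div, integral_div, hi2]
  simp only [integral_const, probReal_univ, smul_eq_mul, one_mul, ENNReal.coe_toReal,
    div_self hq'.ne', le_add_iff_nonneg_right, sub_nonneg]
  exact (div_le_one hd').2 he3

/-- The logarithm of the ratio of the decoding density to the density of the input law. -/
noncomputable def decodingExponent {N L : ℕ} (q d : ℝ≥0) (x : Fin (N + 2) → ℂ)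
    (y : Fin ((N + 2) * L) → ℂ) : ℝ :=
  ∑ k : Fin N, tiltExponent q d
    (symbolEstimate (⟨k, by omega⟩ : Fin (N + 2)) ⟨k + 1, by omega⟩ ⟨k + 2, by omega⟩
      (x ⟨k, by omega⟩) (x ⟨k + 1, by omega⟩) y) (x ⟨k + 2, by omega⟩)

theorem measurable_decodingExponent {N L : ℕ} (q d : ℝ≥0) :
    Measurable fun p : (Fin (N + 2) → ℂ) × (Fin ((N + 2) * L) → ℂ) =>
      decodingExponent q d p.1 p.2 := by
  unfold decodingExponent
  refine Finset.measurable_sum _ fun k _ => ?_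
  exact measurable_tiltExponent_symbolEstimate q d _ _ _

/-- For fixed `y` the decoding law is a Markov chain of order two: each symbol is Gaussian around an
estimate built from the two preceding ones. It is therefore admissible in the Donsker-Varadhan
bound. -/
theorem lintegral_exp_decodingExponent_le {N L : ℕ} {q d : ℝ≥0} (hq : q ≠ 0) (hd : d ≠ 0)
    (y : Fin ((N + 2) * L) → ℂ) :
    ∫⁻ x, ENNReal.ofReal (Real.exp (decodingExponent q d x y))
      ∂(Measure.pi fun _ : Fin (N + 2) => complexGaussian q) ≤ 1 := by
  have h := lintegral_prod_consecutive_le (complexGaussian q) (N := N)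
    (fun k a b c => ENNReal.ofReal (Real.exp (tiltExponent q d
      (symbolEstimate (⟨k, by omega⟩ : Fin (N + 2)) ⟨k + 1, by omega⟩ ⟨k + 2, by omega⟩
        a b y) c))) (fun k => by
        have h1 : Measurable fun p : (ℂ × ℂ) × ℂ =>
            symbolEstimate (⟨k, by omega⟩ : Fin (N + 2)) ⟨k + 1, by omega⟩ ⟨k + 2, by omega⟩
              p.1.1 p.1.2 y :=
          (measurable_symbolEstimate _ _ _).comp (f := fun p : (ℂ × ℂ) × ℂ => (p.1, y))
            (by fun_prop)
        exact ((measurable_tiltExponent q d).comp (h1.prodMk measurable_snd)).exp.ennreal_ofReal)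
    (fun k a b => by
      simp_rw [exp_tiltExponent hq hd]
      exact (lintegral_complexGaussian_tilt_one hq hd _).le)
  refine le_of_eq_of_le (lintegral_congr fun x => ?_) h
  rw [decodingExponent, Real.exp_sum, ENNReal.ofReal_prod_of_nonneg fun k _ => (Real.exp_pos _).le]

theorem ofReal_le_mutualInfo_owpn {N L : ℕ} (hL : L ≠ 0) (σsq : ℝ≥0) {q d : ℝ≥0} (hq : q ≠ 0)
    (hd : d ≠ 0)
    (hqd : q * (3 * σsq) + (q * (2 / L) + (2 / L) * (2 / L)) * q⁻¹ + 2 / L ≤ d) :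
    ENNReal.ofReal (N * Real.log (q / d)) ≤
      mutualInfo ((Measure.pi fun _ : Fin (N + 2) => complexGaussian q).prod
        (owpnNoiseLaw (N + 2) L σsq)) (fun z => z.1) (fun z => owpnOutput (N + 2) L z.1 z.2) := by
  set μ := Measure.pi fun _ : Fin (N + 2) => complexGaussian q with hμ
  set ν := owpnNoiseLaw (N + 2) L σsq with hν
  have hout := measurable_owpnOutput (N + 2) L
  have hpair : Measurable fun z : (Fin (N + 2) → ℂ) × OWPNNoise (N + 2) L =>
      (z.1, owpnOutput (N + 2) L z.1 z.2) := by fun_prop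
  have hF := measurable_decodingExponent (N := N) (L := L) q d
  have hterm := fun k : Fin N => log_le_integral_tiltExponent_symbolEstimate (M := N + 2) hL σsq hq
    hd hqd (i := ⟨k, by omega⟩) (j := ⟨k + 1, by omega⟩) (l := ⟨k + 2, by omega⟩)
    (by simp) (by simp) (by simp)
  have hint : Integrable (fun z : (Fin (N + 2) → ℂ) × OWPNNoise (N + 2) L =>
      decodingExponent q d z.1 (owpnOutput (N + 2) L z.1 z.2)) (μ.prod ν) :=
    integrable_finsetSum _ fun k _ => (hterm k).1
  have hval : N * Real.log (q / d) ≤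
      ∫ z, decodingExponent q d z.1 (owpnOutput (N + 2) L z.1 z.2) ∂(μ.prod ν) := by
    unfold decodingExponent
    rw [integral_finsetSum _ fun k _ => (hterm k).1]
    refine le_trans (le_of_eq ?_) (Finset.sum_le_sum fun k _ => (hterm k).2)
    simp
  have hfst : (μ.prod ν).map (fun z => z.1) = μ := Measure.map_fst_prod.trans (by simp)
  have := Measure.isProbabilityMeasure_map (μ := μ.prod ν) hpair.aemeasurable
  have := Measure.isProbabilityMeasure_map (μ := μ.prod ν) hout.aemeasurable
  rw [mutualInfo, hfst]
  refine le_trans (ENNReal.ofReal_le_ofReal ?_)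
    (ofReal_integral_le_klDiv hF ((integrable_map_measure hF.aestronglyMeasurable
      hpair.aemeasurable).2 hint) ?_)
  · rw [integral_map hpair.aemeasurable hF.aestronglyMeasurable]
    exact hval
  · rw [lintegral_prod_symm _ (hF.exp.ennreal_ofReal).aemeasurable]
    refine (lintegral_mono fun y => lintegral_exp_decodingExponent_le hq hd y).trans ?_
    simp

theorem ofReal_le_owpnCapacity {P : ℝ} (hP : 0 < P) {L : ℕ} (hL : L ≠ 0) (σsq : ℝ≥0) :
    ENNReal.ofReal (Real.log (P / (3 * σsq * P + 4 + 4 / P))) ≤ owpnCapacity P L σsq := by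
  have hLr : (0 : ℝ) < L := by positivity
  set q : ℝ≥0 := ⟨P / L, by positivity⟩ with hqdef
  have hqc : (q : ℝ) = P / L := rfl
  have hq : q ≠ 0 := by
    rw [← NNReal.coe_ne_zero, hqc]; positivity
  -- The mean square error bound itself; it equals `(3σ²P + 4 + 4/P) / L`, so the factor `1/L`
  -- cancels in `q / d`.
  set d : ℝ≥0 := q * (3 * σsq) + (q * (2 / L) + (2 / L) * (2 / L)) * q⁻¹ + 2 / L with hddef
  have hd : d ≠ 0 := by positivity
  set r := Real.log (P / (3 * σsq * P + 4 + 4 / P)) with hr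
  have hqd : Real.log (q / d) = r := by
    have hdc : (d : ℝ) = (3 * σsq * P + 4 + 4 / P) / L := by
      rw [hddef]
      push_cast
      rw [hqc]
      field_simp
      ring
    rw [hdc, hqc, div_div_div_cancel_right₀ hLr.ne']
  have hblock : ∀ N : ℕ, ENNReal.ofReal (N * r / (N + 2)) ≤
      blockCapacity (N + 2) (P / L) (owpnNoiseLaw (N + 2) L σsq) (owpnOutput (N + 2) L) := by
    intro N
    have hpow : PowerConstraint (P / L)
        (Measure.pi fun _ : Fin (N + 2) => complexGaussian q) := by
      rw [PowerConstraint]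
      have : ∀ m : Fin (N + 2), ∫⁻ x, ‖x m‖ₑ ^ 2
          ∂(Measure.pi fun _ : Fin (N + 2) => complexGaussian q) = q := by
        intro m
        rw [(measurePreserving_eval (fun _ : Fin (N + 2) => complexGaussian q) m).lintegral_comp
          (f := fun w => ‖w‖ₑ ^ 2) (by fun_prop), lintegral_enorm_sq_complexGaussian]
      simp_rw [this]
      rw [Finset.sum_const, Finset.card_univ, Fintype.card_fin, nsmul_eq_mul,
        ENNReal.mul_div_right_comm, ENNReal.div_self (by positivity) (by simp), one_mul, ← hqc,
        ENNReal.ofReal_coe_nnreal]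
    refine le_trans ?_ (le_iSup₂_of_le (Measure.pi fun _ : Fin (N + 2) => complexGaussian q)
      inferInstance (le_iSup_of_le hpow le_rfl))
    rw [ENNReal.ofReal_div_of_pos (by positivity), ← hqd]
    have e : ENNReal.ofReal ((N : ℝ) + 2) = ((N + 2 : ℕ) : ℝ≥0∞) := by
      rw [← ENNReal.ofReal_natCast]; push_cast; rfl
    rw [e]
    exact ENNReal.div_le_div_right (ofReal_le_mutualInfo_owpn hL σsq hq hd le_rfl) _
  -- The two symbols without pilots cost only the factor `N / (N + 2)`, which tends to one.
  have hlim : Tendsto (fun N : ℕ => ENNReal.ofReal (N * r / (N + 2))) atTop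
      (nhds (ENNReal.ofReal r)) := by
    apply ENNReal.tendsto_ofReal
    have h := (tendsto_natCast_div_add_atTop (2 : ℝ)).mul_const r
    rw [one_mul] at h
    refine h.congr fun N => ?_
    ring
  rw [← hlim.limsup_eq, owpnCapacity]
  exact (limsup_le_limsup (Eventually.of_forall hblock)).trans_eq (limsup_nat_add
    (fun M => blockCapacity M (P / L) (owpnNoiseLaw M L σsq) (owpnOutput M L)) 2)

-- Numerical comparison of the two capacity bounds

theorem log_sub_half_log_le {P s : ℝ} (hP : 0 < P) (hs0 : 0 ≤ s) (hs : s < 1 / (2 * P))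
    (hlarge : 1 / 2 * Real.log (2 * Real.pi * Real.exp 1) < Real.log (1 + P / 2)) :
    Real.log (1 + P / 2) - 1 / 2 * Real.log (2 * Real.pi * Real.exp 1) ≤
      Real.log (P / (3 * s * P + 4 + 4 / P)) := by
  set c := 2 * Real.pi * Real.exp 1 with hc
  have hc0 : 0 < c := by positivity
  -- A rational lower bound for `√(2πe) ≈ 4.13`; then `1 + P/2 > 4.11` forces `P ≥ 6.22`.
  have hc1 : 4.11 ^ 2 ≤ c := by
    have h1 := Real.pi_gt_d2
    have h2 := Real.exp_one_gt_d9
    have : 3.14 * 2.7182818283 ≤ Real.pi * Real.exp 1 := by gcongr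
    rw [hc]
    linarith
  have hsqrt : 4.11 ≤ √c := Real.le_sqrt_of_sq_le hc1
  have hlog : 1 / 2 * Real.log c = Real.log √c := by
    rw [Real.log_sqrt hc0.le]; ring
  rw [hlog] at hlarge ⊢
  have hPlarge : √c < 1 + P / 2 := (Real.log_lt_log_iff (by positivity) (by positivity)).1 hlarge
  have hP6 : 6.22 ≤ P := by linarith
  have hsP : 3 * s * P ≤ 1.5 := by
    rw [lt_div_iff₀ (by positivity)] at hs
    linarith
  rw [← Real.log_div (by positivity) (by positivity)]
  apply Real.log_le_log (by positivity)
  rw [div_le_div_iff₀ (by positivity) (by positivity)]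
  -- After division by `P` the claim is `2.75 + 7.5/P + 4/P² ≤ √(2πe)`, and `P ≥ 6.22` suffices.
  calc (1 + P / 2) * (3 * s * P + 4 + 4 / P) ≤ (1 + P / 2) * (1.5 + 4 + 4 / P) := by gcongr
    _ = 2.75 * P + 7.5 + 4 / P := by field_simp; ring
    _ ≤ 2.75 * P + 7.5 + 4 / 6.22 := by gcongr
    _ ≤ P * 4.11 := by linarith
    _ ≤ P * √c := by gcongr

end PhaseNoise

theorem mainTheorem9 (P : ℝ) (hP : 0 < P) (L : ℕ) (hL : 1 ≤ L) (σsq : ℝ≥0) :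
    PhaseNoise.awgnCapacity P < ⊤ ∧
    PhaseNoise.owpnCapacity P L σsq ≤ PhaseNoise.awgnCapacity P ∧
    (1.5 < P → (σsq : ℝ) < 1 / (2 * P) →
      (PhaseNoise.awgnCapacity P).toReal - (PhaseNoise.owpnCapacity P L σsq).toReal
        ≤ 1 / 2 * Real.log (2 * Real.pi * Real.exp 1)) := by
  have hL0 : L ≠ 0 := by omega
  have hup := PhaseNoise.awgnCapacity_le hP
  have hfin : PhaseNoise.awgnCapacity P < ⊤ := hup.trans_lt ENNReal.ofReal_lt_top
  have hle := PhaseNoise.owpnCapacity_le_awgnCapacity hL0 P σsq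
  refine ⟨hfin, hle, fun _ hσ => ?_⟩
  have hupr : (PhaseNoise.awgnCapacity P).toReal ≤ Real.log (1 + P / 2) :=
    ENNReal.toReal_le_of_le_ofReal (Real.log_nonneg (by linarith)) hup
  have hlow := (ENNReal.ofReal_le_iff_le_toReal (hle.trans_lt hfin).ne).1
    (PhaseNoise.ofReal_le_owpnCapacity hP hL0 σsq)
  -- If the upper bound on the Gaussian capacity is already at most the allowed gap, nonnegativity
  -- of the other capacity is enough.
  rcases le_or_gt (Real.log (1 + P / 2)) (1 / 2 * Real.log (2 * Real.pi * Real.exp 1)) with h | h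
  · have : 0 ≤ (PhaseNoise.owpnCapacity P L σsq).toReal := ENNReal.toReal_nonneg
    linarith
  · have := PhaseNoise.log_sub_half_log_le hP σsq.coe_nonneg hσ h
    linarith
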